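/- Let $S=(S_t)_{t\in\mathbb R}$ be a two-sided subordinator, i.e. $S_t=-L^{(1)}_{(-t)-}\mathbf 1_{\{t<0\}}+L^{(2)}_t\mathbf 1_{\{t\ge 0\}}$ with independent, identically distributed subordinators $L^{(1)},L^{(2)}$ (nondecreasing Lévy processes), and assume $E(S_1^2)<\infty$. Let $a>0$ and $d\in(-0.5,0)$, and let $$f_{a,d}(t,s)=\bigl(a+\max(-s,0)\bigr)^d-\bigl(a+\max(t-s,0)\bigr)^d,\qquad s,t\in\mathbb R .$$ The modified Mandelbrot–van Ness fractional subordinator $S^{a,d}_t=\int_{\mathbb R}f_{a,d}(t,u)\,dS_u$, $t\in\mathbb R$, is defined as the $L^2(\Omega)$-limit of the integrals $\sum_i c_i(S_{r_i}-S_{l_i})$ of step functions $\sum_i c_i\mathbf 1_{(l_i,r_i]}$ that converge to $f_{a,d}(t,\cdot)$ in $L^1(\mathbb R)$ and in $L^2(\mathbb R)$. Then $S^{a,d}$ exists, and every version of it has the following properties. (i) $S^{a,d}$ has stationary increments: for all $t_0\le\dots\le t_n$ and $h\in\mathbb R$, the vectors $(S^{a,d}_{t_i+h}-S^{a,d}_{t_{i-1}+h})_{1\le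 i\le n}$ and $(S^{a,d}_{t_i}-S^{a,d}_{t_{i-1}})_{1\le i\le n}$ have the same distribution. (ii) Fix $r>0$. For real $h>0$ the covariance $$\gamma_r(h)=\mathrm{Cov}\bigl(S^{a,d}_{s+(h+1)r}-S^{a,d}_{s+hr},\;S^{a,d}_{s+r}-S^{a,d}_{s}\bigr)$$ does not depend on $s\in\mathbb R$, and $$\gamma_r(h)\sim \mathrm{Var}(S_1)\,|d|\,a^d\,r^2\,(hr+a)^{d-1},\qquad h\to\infty ,$$ where, if $\mathrm{Var}(S_1)=0$, this means that $\gamma_r(h)=0$ for all sufficiently large $h$. In particular, if $\mathrm{Var}(S_1)>0$, the increments are asymptotically positively correlated with algebraic decay: $\gamma_r(h)>0$ for all sufficiently large $h$, and $\gamma_r(h)$ is of exact order $h^{d-1}$, i.e. there are constants $0<c\le C$ with $c\,h^{d-1}\le\gamma_r(h)\le C\,h^{d-1}$ for all sufficiently large $h$. -/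

import Mathlib

open MeasureTheory ProbabilityTheory Filter Topology Asymptotics
open scoped NNReal ENNReal

/-- A subordinator: a real-valued Lévy process `(L_t)_{t ≥ 0}` (started in `0`, with independent
and stationary increments and right-continuous paths) whose paths are almost surely nondecreasing.
Left limits of the paths exist because the paths are monotone. -/
structure IsSubordinator {Ω : Type*} [MeasurableSpace Ω] (L : ℝ≥0 → Ω → ℝ) (P : Measure Ω) :
    Prop where
  measurable : ∀ t, Measurable (L t)
  zero : ∀ᵐ ω ∂P, L 0 ω = 0
  indep_increments : HasIndepIncrements L P
  stationary_increments :
    ∀ s t : ℝ≥0, IdentDistrib (fun ω => L (s + t) ω - L s ω) (L t) P P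
  monotone_paths : ∀ᵐ ω ∂P, Monotone (fun t => L t ω)
  right_continuous_paths :
    ∀ᵐ ω ∂P, ∀ t : ℝ≥0, ContinuousWithinAt (fun u => L u ω) (Set.Ici t) t

/-- A two-sided subordinator: `S_t = -L¹_{(-t)-}` for `t < 0` and `S_t = L²_t` for `t ≥ 0`, where
`L¹` and `L²` are independent and identically distributed subordinators. -/
def IsTwoSidedSubordinator {Ω : Type*} [MeasurableSpace Ω] (S : ℝ → Ω → ℝ) (P : Measure Ω) :
    Prop :=
  ∃ L₁ L₂ : ℝ≥0 → Ω → ℝ,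
    IsSubordinator L₁ P ∧ IsSubordinator L₂ P ∧
    IdentDistrib (fun ω t => L₁ t ω) (fun ω t => L₂ t ω) P P ∧
    IndepFun (fun ω t => L₁ t ω) (fun ω t => L₂ t ω) P ∧
    ∀ t ω, S t ω =
      if t < 0 then -Function.leftLim (fun u => L₁ u ω) (-t).toNNReal else L₂ t.toNNReal ω

/-- Data of a step function `∑ i, c i • 1_{(l i, r i]}` on the real line. -/
structure StepFunction where
  n : ℕ
  c : Fin n → ℝ
  l : Fin n → ℝ
  r : Fin n → ℝ
  l_le_r : ∀ i, l i ≤ r i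

/-- The step function `∑ i, c i • 1_{(l i, r i]}` itself. -/
noncomputable def StepFunction.eval (φ : StepFunction) (u : ℝ) : ℝ :=
  ∑ i, φ.c i * (Set.Ioc (φ.l i) (φ.r i)).indicator (fun _ => (1 : ℝ)) u

/-- The elementary stochastic integral `∫ φ dS = ∑ i, c i (S_{r i} - S_{l i})`. -/
def StepFunction.integral {Ω : Type*} (φ : StepFunction) (S : ℝ → Ω → ℝ) (ω : Ω) : ℝ :=
  ∑ i, φ.c i * (S (φ.r i) ω - S (φ.l i) ω)

/-- `X` is (a version of) the stochastic integral `∫_ℝ f(u) dS_u` of a deterministic integrand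
`f ∈ L¹(ℝ) ∩ L²(ℝ)` with respect to a two-sided process `S` with finite second moments:
`X ∈ L²(Ω)` is the `L²(Ω)`-limit (in particular the limit in probability) of the elementary
integrals of step functions that converge to `f` both in `L¹(ℝ)` and in `L²(ℝ)`. -/
def IsStochIntegral {Ω : Type*} [MeasurableSpace Ω] (P : Measure Ω) (S : ℝ → Ω → ℝ)
    (f : ℝ → ℝ) (X : Ω → ℝ) : Prop :=
  MemLp f 1 volume ∧ MemLp f 2 volume ∧ MemLp X 2 P ∧
  ∃ φ : ℕ → StepFunction,
    Tendsto (fun k => eLpNorm (fun u => (φ k).eval u - f u) 1 volume) atTop (𝓝 0) ∧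
    Tendsto (fun k => eLpNorm (fun u => (φ k).eval u - f u) 2 volume) atTop (𝓝 0) ∧
    Tendsto (fun k => eLpNorm (fun ω => (φ k).integral S ω - X ω) 2 P) atTop (𝓝 0)

/-- The function `g_{a,d}(x) = (a + x₊)^d`. -/
noncomputable def shiftedPower (a d x : ℝ) : ℝ := (a + max x 0) ^ d

/-- The non-normalized modified Mandelbrot–van Ness kernel
`f_{a,d}(t,s) = (a + (-s)₊)^d - (a + (t-s)₊)^d`. -/
noncomputable def modMvNKernel (a d t s : ℝ) : ℝ :=
  shiftedPower a d (-s) - shiftedPower a d (t - s)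

/-- `Z` is (a version of) the fractional subordinator `S^{a,d}_t = ∫_ℝ f_{a,d}(t,u) dS_u`. -/
def IsModMvNSubordinator {Ω : Type*} [MeasurableSpace Ω] (P : Measure Ω) (S : ℝ → Ω → ℝ)
    (a d : ℝ) (Z : ℝ → Ω → ℝ) : Prop :=
  ∀ t : ℝ, IsStochIntegral P S (modMvNKernel a d t) (Z t)

/-- Stationary increments: for all `t₀ ≤ ⋯ ≤ tₙ` and all `h`, the vectors
`(Z_{tᵢ + h} - Z_{tᵢ₋₁ + h})ᵢ` and `(Z_{tᵢ} - Z_{tᵢ₋₁})ᵢ` have the same law. -/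
def HasStationaryIncrements {Ω : Type*} [MeasurableSpace Ω] (Z : ℝ → Ω → ℝ) (P : Measure Ω) :
    Prop :=
  ∀ (h : ℝ) (n : ℕ) (t : Fin (n + 1) → ℝ), Monotone t →
    IdentDistrib
      (fun ω (i : Fin n) => Z (t i.succ + h) ω - Z (t i.castSucc + h) ω)
      (fun ω (i : Fin n) => Z (t i.succ) ω - Z (t i.castSucc) ω) P P

theorem NNReal.eq_mul_of_additive_of_nonneg {f : ℝ≥0 → ℝ} (hadd : ∀ s t, f (s + t) = f s + f t)
    (hnn : ∀ t, 0 ≤ f t) (t : ℝ≥0) : f t = t * f 1 := by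
  have h0 : f 0 = 0 := by have := hadd 0 0; simp at this; exact this
  have hmul : ∀ (n : ℕ) (s : ℝ≥0), f (n * s) = n * f s := by
    intro n s
    induction n with
    | zero => simp [h0]
    | succ n ih => push_cast; rw [add_mul, hadd, ih, one_mul]; ring
  have hmono : Monotone f := by
    intro s u hsu
    obtain ⟨w, rfl⟩ := exists_add_of_le hsu
    rw [hadd]; linarith [hnn w]
  have key : ∀ n : ℕ, n * |f t - t * f 1| ≤ f 1 := by
    intro n
    set k := ⌊(n : ℝ≥0) * t⌋₊
    have hk : (k : ℝ≥0) ≤ n * t := Nat.floor_le zero_le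
    have hk' : (n : ℝ≥0) * t ≤ (k + 1 : ℕ) := by
      push_cast; exact (Nat.lt_floor_add_one _).le
    have h1 := hmono hk
    have h2 := hmono hk'
    have e : ∀ j : ℕ, f j = j * f 1 := fun j => by simpa using hmul j 1
    rw [hmul, e] at h1
    rw [hmul, e] at h2
    have hk1 : (k : ℝ) ≤ n * t := by exact_mod_cast hk
    have hk2 : (n : ℝ) * t ≤ k + 1 := by exact_mod_cast hk'
    push_cast at h2
    have hf1 := hnn 1
    have e2 : (n : ℝ) * |f t - t * f 1| = |n * f t - n * t * f 1| := by
      rw [← abs_of_nonneg (Nat.cast_nonneg (α := ℝ) n), ← abs_mul,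
        abs_of_nonneg (Nat.cast_nonneg (α := ℝ) n)]
      ring_nf
    rw [e2, abs_le]
    constructor <;> nlinarith
  by_contra hne
  have hpos : 0 < |f t - t * f 1| := abs_pos.2 (sub_ne_zero.2 hne)
  obtain ⟨n, hn⟩ := exists_nat_gt (f 1 / |f t - t * f 1|)
  rw [div_lt_iff₀ hpos] at hn
  linarith [key n]

namespace IsSubordinator

variable {Ω : Type*} [MeasurableSpace Ω] {P : Measure Ω} {L : ℝ≥0 → Ω → ℝ}

theorem ae_nonneg (hL : IsSubordinator L P) : ∀ᵐ ω ∂P, ∀ t, 0 ≤ L t ω := by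
  filter_upwards [hL.zero, hL.monotone_paths] with ω h0 hm t
  rw [← h0]
  exact hm zero_le

theorem indepFun_add_sub (hL : IsSubordinator L P) (s t : ℝ≥0) :
    IndepFun (L s) (fun ω => L (s + t) ω - L s ω) P :=
  hL.indep_increments.indepFun_eval_sub zero_le le_self_add hL.zero

theorem memLp (hL : IsSubordinator L P) (h1 : MemLp (L 1) 2 P) (t : ℝ≥0) : MemLp (L t) 2 P := by
  have hnat : ∀ n : ℕ, MemLp (L n) 2 P := by
    intro n
    induction n with
    | zero =>
      have : L 0 =ᵐ[P] fun _ => (0 : ℝ) := hL.zero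
      simpa using (memLp_congr_ae this).2 MemLp.zero
    | succ n ih =>
      have h := ih.add ((hL.stationary_increments n 1).memLp_iff.2 h1)
      convert h using 1
      ext ω
      simp
  refine (hnat ⌈t⌉₊).mono (hL.measurable t).aestronglyMeasurable ?_
  filter_upwards [hL.ae_nonneg, hL.monotone_paths] with ω h0 hm
  rw [Real.norm_of_nonneg (h0 _), Real.norm_of_nonneg (h0 _)]
  exact hm (Nat.le_ceil t)

theorem variance_eq (hL : IsSubordinator L P) (h1 : MemLp (L 1) 2 P) (t : ℝ≥0) :
    variance (L t) P = t * variance (L 1) P := by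
  refine NNReal.eq_mul_of_additive_of_nonneg (f := fun t => variance (L t) P) (fun s t => ?_)
    (fun t => variance_nonneg _ _) t
  have h := (hL.indepFun_add_sub s t).variance_add (hL.memLp h1 s)
    ((hL.memLp h1 (s + t)).sub (hL.memLp h1 s))
  have h' : variance (L (s + t) - L s) P = variance (L t) P :=
    (hL.stationary_increments s t).variance_eq
  have e1 : L s + (L (s + t) - L s) = L (s + t) := by
    ext ω
    simp
  rw [h', e1] at h
  exact h

variable [IsProbabilityMeasure P]

theorem integral_eq (hL : IsSubordinator L P) (h1 : MemLp (L 1) 2 P) (t : ℝ≥0) :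
    ∫ ω, L t ω ∂P = t * ∫ ω, L 1 ω ∂P := by
  refine NNReal.eq_mul_of_additive_of_nonneg (f := fun t => ∫ ω, L t ω ∂P) (fun s t => ?_)
    (fun t => integral_nonneg_of_ae (hL.ae_nonneg.mono fun ω h => h t)) t
  have hi : ∀ u, Integrable (L u) P := fun u => (hL.memLp h1 u).integrable one_le_two
  have h := (hL.stationary_increments s t).integral_eq
  rw [integral_sub (hi _) (hi _)] at h
  linarith

theorem leftLim_ae_eq (hL : IsSubordinator L P) (h1 : MemLp (L 1) 2 P) {t : ℝ≥0} (ht : 0 < t) :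
    (fun ω => Function.leftLim (fun u => L u ω) t) =ᵐ[P] L t := by
  obtain ⟨x, -, hxt, hx⟩ := exists_seq_strictMono_tendsto' ht
  have hi : ∀ u, Integrable (L u) P := fun u => (hL.memLp h1 u).integrable one_le_two
  have hxt' : ∀ n, x n < t := fun n => (hxt n).2
  have hL1 : Tendsto (fun n => eLpNorm (L (x n) - L t) 1 P) atTop (𝓝 0) := by
    have e : ∀ n, eLpNorm (L (x n) - L t) 1 P
        = ENNReal.ofReal (((t : ℝ) - x n) * ∫ ω, L 1 ω ∂P) := by
      intro n
      rw [eLpNorm_one_eq_lintegral_enorm, ← ofReal_integral_norm_eq_lintegral_enorm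
        ((hi _).sub (hi _)), sub_mul, ← hL.integral_eq h1, ← hL.integral_eq h1,
        ← integral_sub (hi _) (hi _)]
      congr 1
      refine integral_congr_ae ?_
      filter_upwards [hL.monotone_paths] with ω hm
      have := hm (hxt' n).le
      simp only [Pi.sub_apply, Real.norm_eq_abs] at this ⊢
      rw [abs_of_nonpos (by linarith)]
      ring
    simp_rw [e]
    have hx' : Tendsto (fun n => (x n : ℝ)) atTop (𝓝 (t : ℝ)) :=
      NNReal.tendsto_coe.2 hx
    have := ENNReal.tendsto_ofReal
      (((tendsto_const_nhds (x := (t : ℝ))).sub hx').mul_const (∫ ω, L 1 ω ∂P))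
    simpa using this
  have hmeas := tendstoInMeasure_of_tendsto_eLpNorm one_ne_zero
    (fun n => (hL.measurable (x n)).aestronglyMeasurable)
    (hL.measurable t).aestronglyMeasurable hL1
  obtain ⟨ns, hns, hae⟩ := hmeas.exists_seq_tendsto_ae
  filter_upwards [hae, hL.monotone_paths] with ω h hm
  refine tendsto_nhds_unique ((hm.tendsto_leftLim t).comp ?_) h
  exact tendsto_nhdsWithin_iff.2 ⟨hx.comp hns.tendsto_atTop, Eventually.of_forall fun n => hxt' _⟩

end IsSubordinator

/-- A real-valued process on the real line with finite second moments and independent, stationary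
increments, whose increments have mean `m (t - s)` and variance `v |t - s|`. -/
structure IsSquareIntegrableLevy {Ω : Type*} [MeasurableSpace Ω] (S : ℝ → Ω → ℝ) (P : Measure Ω)
    (m v : ℝ) : Prop where
  memLp : ∀ t, MemLp (S t) 2 P
  indep_increments : HasIndepIncrements S P
  stationary_increments : ∀ s t h, s ≤ t →
    IdentDistrib (fun ω => S (t + h) ω - S (s + h) ω) (fun ω => S t ω - S s ω) P P
  integral_increment : ∀ s t, ∫ ω, (S t ω - S s ω) ∂P = m * (t - s)
  variance_increment : ∀ s t, variance (fun ω => S t ω - S s ω) P = v * |t - s|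

theorem ProbabilityTheory.iIndepFun.add_of_indepFun {Ω ι : Type*} [MeasurableSpace Ω] [Fintype ι]
    {P : Measure Ω} [IsProbabilityMeasure P] {A B : ι → Ω → ℝ} (hAm : ∀ i, AEMeasurable (A i) P)
    (hBm : ∀ i, AEMeasurable (B i) P) (hA : iIndepFun A P) (hB : iIndepFun B P)
    (hAB : IndepFun (fun ω i => A i ω) (fun ω i => B i ω) P) :
    iIndepFun (fun i ω => A i ω + B i ω) P := by
  have hm : Measurable (fun x : ι → ℝ => WithLp.toLp 2 x) := by fun_prop
  rw [iIndepFun_iff_charFun_pi (X := fun i ω => A i ω + B i ω) (fun i => (hAm i).add (hBm i))]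
  intro t
  have h1 := IndepFun.charFun_map_fun_add_eq_mul
    (X := fun ω => WithLp.toLp 2 (fun i => A i ω)) (Y := fun ω => WithLp.toLp 2 (fun i => B i ω))
    (hm.comp_aemeasurable (aemeasurable_pi_lambda _ hAm))
    (hm.comp_aemeasurable (aemeasurable_pi_lambda _ hBm)) (hAB.comp hm hm)
  have h2 : (fun ω => WithLp.toLp 2 (fun i => A i ω + B i ω))
      = fun ω => WithLp.toLp 2 (fun i => A i ω) + WithLp.toLp 2 (fun i => B i ω) := rfl
  rw [h2, h1, Pi.mul_apply, (iIndepFun_iff_charFun_pi hAm).1 hA, (iIndepFun_iff_charFun_pi hBm).1 hB,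
    ← Finset.prod_mul_distrib]
  refine Finset.prod_congr rfl fun i _ => ?_
  have hi : IndepFun (A i) (B i) P := hAB.comp (measurable_pi_apply i) (measurable_pi_apply i)
  rw [hi.charFun_map_fun_add_eq_mul (hAm i) (hBm i), Pi.mul_apply]

/-- A modification of the two-sided subordinator without left limits. -/
def twoSidedProcess {Ω : Type*} (L₁ L₂ : ℝ≥0 → Ω → ℝ) (t : ℝ) (ω : Ω) : ℝ :=
  L₂ t.toNNReal ω - L₁ (-t).toNNReal ω

theorem twoSidedProcess_sub {Ω : Type*} (L₁ L₂ : ℝ≥0 → Ω → ℝ) (s t : ℝ) (ω : Ω) :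
    twoSidedProcess L₁ L₂ t ω - twoSidedProcess L₁ L₂ s ω =
      (L₂ t.toNNReal ω - L₂ s.toNNReal ω) + (L₁ (-s).toNNReal ω - L₁ (-t).toNNReal ω) := by
  simp only [twoSidedProcess]
  ring

section TwoSided

variable {Ω : Type*} [MeasurableSpace Ω] {P : Measure Ω} [IsProbabilityMeasure P]
  {L₁ L₂ : ℝ≥0 → Ω → ℝ}

theorem hasIndepIncrements_twoSidedProcess (h₁ : IsSubordinator L₁ P) (h₂ : IsSubordinator L₂ P)
    (hind : IndepFun (fun ω t => L₁ t ω) (fun ω t => L₂ t ω) P) :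
    HasIndepIncrements (twoSidedProcess L₁ L₂) P := by
  intro n t ht
  simp_rw [twoSidedProcess_sub]
  have m1 := h₁.measurable
  have m2 := h₂.measurable
  refine iIndepFun.add_of_indepFun (A := fun (i : Fin n) ω => L₂ (t i.succ).toNNReal ω
      - L₂ (t i.castSucc).toNNReal ω) (B := fun (i : Fin n) ω => L₁ (-(t i.castSucc)).toNNReal ω
      - L₁ (-(t i.succ)).toNNReal ω)
    (fun i => ((m2 _).sub (m2 _)).aemeasurable) (fun i => ((m1 _).sub (m1 _)).aemeasurable)
    (h₂.indep_increments n (fun i => (t i).toNNReal) fun i j hij => Real.toNNReal_mono (ht hij))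
    ?_ ?_
  · have h := h₁.indep_increments n (fun i => (-(t i.rev)).toNNReal)
      fun i j hij => Real.toNNReal_mono (neg_le_neg (ht (Fin.rev_le_rev.2 hij)))
    have h' := h.precomp (g := Fin.rev) Fin.rev_injective
    convert h' using 2 with i
    ext ω
    simp [Fin.rev_succ, Fin.rev_castSucc]
  · refine hind.symm.comp (φ := fun (x : ℝ≥0 → ℝ) (i : Fin n) => x (t i.succ).toNNReal - x (t i.castSucc).toNNReal)
      (ψ := fun (x : ℝ≥0 → ℝ) (i : Fin n) => x (-(t i.castSucc)).toNNReal - x (-(t i.succ)).toNNReal) ?_ ?_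
    · fun_prop
    · fun_prop

theorem identDistrib_twoSidedProcess_sub (h₁ : IsSubordinator L₁ P) (h₂ : IsSubordinator L₂ P)
    (hid : IdentDistrib (fun ω t => L₁ t ω) (fun ω t => L₂ t ω) P P)
    (hind : IndepFun (fun ω t => L₁ t ω) (fun ω t => L₂ t ω) P) {s t : ℝ} (hst : s ≤ t) :
    IdentDistrib (fun ω => twoSidedProcess L₁ L₂ t ω - twoSidedProcess L₁ L₂ s ω)
      (L₂ (t - s).toNNReal) P P := by
  simp_rw [twoSidedProcess_sub]
  obtain ⟨p, hp⟩ := exists_add_of_le (Real.toNNReal_mono hst)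
  obtain ⟨q, hq⟩ := exists_add_of_le (Real.toNNReal_mono (neg_le_neg hst))
  have hpq : (t - s).toNNReal = p + q := by
    have hp' : max t 0 = max s 0 + p := by
      have := congrArg NNReal.toReal hp
      simpa [Real.coe_toNNReal'] using this
    have hq' : max (-s) 0 = max (-t) 0 + q := by
      have := congrArg NNReal.toReal hq
      simpa [Real.coe_toNNReal'] using this
    apply NNReal.eq
    rw [Real.coe_toNNReal _ (by linarith), NNReal.coe_add]
    have e : ∀ x : ℝ, max x 0 - max (-x) 0 = x := fun x => by
      rcases le_total x 0 with h | h <;> simp [h]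
    linarith [e s, e t]
  have hA : IdentDistrib (fun ω => L₂ t.toNNReal ω - L₂ s.toNNReal ω) (L₂ p) P P := by
    rw [hp]
    exact h₂.stationary_increments _ _
  have hB : IdentDistrib (fun ω => L₁ (-s).toNNReal ω - L₁ (-t).toNNReal ω)
      (fun ω => L₂ (p + q) ω - L₂ p ω) P P := by
    rw [hq]
    exact ((h₁.stationary_increments _ _).trans
      (hid.comp (measurable_pi_apply q))).trans (h₂.stationary_increments p q).symm
  have hI : IndepFun (fun ω => L₂ t.toNNReal ω - L₂ s.toNNReal ω)
      (fun ω => L₁ (-s).toNNReal ω - L₁ (-t).toNNReal ω) P :=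
    hind.symm.comp (φ := fun x : ℝ≥0 → ℝ => x t.toNNReal - x s.toNNReal)
      (ψ := fun x : ℝ≥0 → ℝ => x (-s).toNNReal - x (-t).toNNReal) (by fun_prop) (by fun_prop)
  have h := (hA.prodMk hB hI (h₂.indepFun_add_sub p q)).comp
    (u := fun x : ℝ × ℝ => x.1 + x.2) (by fun_prop)
  have e : L₂ (p + q) = (fun x : ℝ × ℝ => x.1 + x.2) ∘ fun ω => (L₂ p ω, L₂ (p + q) ω - L₂ p ω) := by
    ext ω
    simp
  rw [hpq, e]
  exact h

theorem isSquareIntegrableLevy_twoSidedProcess (h₁ : IsSubordinator L₁ P)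
    (h₂ : IsSubordinator L₂ P) (hid : IdentDistrib (fun ω t => L₁ t ω) (fun ω t => L₂ t ω) P P)
    (hind : IndepFun (fun ω t => L₁ t ω) (fun ω t => L₂ t ω) P) (hL : MemLp (L₂ 1) 2 P) :
    IsSquareIntegrableLevy (twoSidedProcess L₁ L₂) P (∫ ω, L₂ 1 ω ∂P) (variance (L₂ 1) P) := by
  have hL1 : MemLp (L₁ 1) 2 P := (hid.comp (measurable_pi_apply 1)).memLp_iff.2 hL
  have hm : ∀ t, MemLp (twoSidedProcess L₁ L₂ t) 2 P := fun t =>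
    (h₂.memLp hL _).sub (h₁.memLp hL1 _)
  have hi : ∀ t, Integrable (twoSidedProcess L₁ L₂ t) P := fun t => (hm t).integrable one_le_two
  have hinc := fun {s t : ℝ} (hst : s ≤ t) =>
    identDistrib_twoSidedProcess_sub h₁ h₂ hid hind hst
  have hmean : ∀ s t, s ≤ t → ∫ ω, twoSidedProcess L₁ L₂ t ω ∂P
      - ∫ ω, twoSidedProcess L₁ L₂ s ω ∂P = (∫ ω, L₂ 1 ω ∂P) * (t - s) := by
    intro s t hst
    rw [← integral_sub (hi t) (hi s), (hinc hst).integral_eq, h₂.integral_eq hL,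
      Real.coe_toNNReal _ (by linarith), mul_comm]
  have hvar : ∀ s t, s ≤ t →
      variance (fun ω => twoSidedProcess L₁ L₂ t ω - twoSidedProcess L₁ L₂ s ω) P
        = variance (L₂ 1) P * (t - s) := by
    intro s t hst
    rw [(hinc hst).variance_eq, h₂.variance_eq hL, Real.coe_toNNReal _ (by linarith), mul_comm]
  refine ⟨hm, hasIndepIncrements_twoSidedProcess h₁ h₂ hind, fun s t h hst => ?_, fun s t => ?_,
    fun s t => ?_⟩
  · have h' := (hinc (add_le_add_left hst h))
    rw [add_sub_add_right_eq_sub] at h'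
    exact h'.trans (hinc hst).symm
  · rw [integral_sub (hi t) (hi s)]
    rcases le_total s t with h | h
    · exact hmean s t h
    · linarith [hmean t s h]
  · rcases le_total s t with h | h
    · rw [hvar s t h, abs_of_nonneg (by linarith)]
    · rw [abs_of_nonpos (by linarith), neg_sub, ← hvar t s h, ← variance_fun_neg]
      simp_rw [neg_sub]

end TwoSided

theorem IsSquareIntegrableLevy.congr {Ω : Type*} [MeasurableSpace Ω] {P : Measure Ω}
    {S T : ℝ → Ω → ℝ} {m v : ℝ} (hS : IsSquareIntegrableLevy S P m v) (h : ∀ t, S t =ᵐ[P] T t) :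
    IsSquareIntegrableLevy T P m v := by
  have hsub : ∀ s t, (fun ω => S t ω - S s ω) =ᵐ[P] fun ω => T t ω - T s ω :=
    fun s t => (h t).sub (h s)
  refine ⟨fun t => (memLp_congr_ae (h t)).1 (hS.memLp t), fun n t ht => ?_, fun s t u hst => ?_,
    fun s t => ?_, fun s t => ?_⟩
  · exact (iIndepFun_congr fun i => hsub _ _).1 (hS.indep_increments n t ht)
  · have haem : ∀ t, AEMeasurable (T t) P := fun t =>
      ((hS.memLp t).aestronglyMeasurable.aemeasurable).congr (h t)
    exact ((IdentDistrib.of_ae_eq ((haem _).sub (haem _)) (hsub _ _).symm).trans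
      (hS.stationary_increments s t u hst)).trans
      (IdentDistrib.of_ae_eq ((haem _).sub (haem _)) (hsub _ _).symm).symm
  · rw [← hS.integral_increment, integral_congr_ae (hsub s t)]
  · rw [← hS.variance_increment, variance_congr (hsub s t)]

theorem IsTwoSidedSubordinator.isSquareIntegrableLevy {Ω : Type*} [MeasurableSpace Ω]
    {P : Measure Ω} [IsProbabilityMeasure P] {S : ℝ → Ω → ℝ} (hS : IsTwoSidedSubordinator S P)
    (hS2 : MemLp (S 1) 2 P) :
    IsSquareIntegrableLevy S P (∫ ω, S 1 ω ∂P) (variance (S 1) P) := by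
  obtain ⟨L₁, L₂, h₁, h₂, hid, hind, hSL⟩ := hS
  have hS1 : S 1 = L₂ 1 := by
    ext ω
    rw [hSL, if_neg (by norm_num), Real.toNNReal_one]
  rw [hS1] at hS2 ⊢
  refine (isSquareIntegrableLevy_twoSidedProcess h₁ h₂ hid hind hS2).congr fun t => ?_
  have hL1 : MemLp (L₁ 1) 2 P := (hid.comp (measurable_pi_apply 1)).memLp_iff.2 hS2
  rcases lt_or_ge t 0 with ht | ht
  · filter_upwards [h₁.leftLim_ae_eq hL1 (t := (-t).toNNReal) (by simpa using ht), h₂.zero]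
      with ω h h0
    rw [hSL, if_pos ht, h, twoSidedProcess, Real.toNNReal_of_nonpos ht.le, h0, zero_sub]
  · filter_upwards [h₁.zero] with ω h0
    rw [hSL, if_neg (not_lt.2 ht), twoSidedProcess, Real.toNNReal_of_nonpos (neg_nonpos.2 ht), h0,
      sub_zero]

namespace StepFunction

/-- The difference of two step functions. -/
def sub (φ ψ : StepFunction) : StepFunction where
  n := φ.n + ψ.n
  c := Fin.append φ.c (fun i => -ψ.c i)
  l := Fin.append φ.l ψ.l
  r := Fin.append φ.r ψ.r
  l_le_r i := by
    induction i using Fin.addCases with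
    | left i => simpa using φ.l_le_r i
    | right i => simpa using ψ.l_le_r i

/-- The translate `u ↦ φ (u - h)` of a step function. -/
def shift (φ : StepFunction) (h : ℝ) : StepFunction where
  n := φ.n
  c := φ.c
  l i := φ.l i + h
  r i := φ.r i + h
  l_le_r i := add_le_add_left (φ.l_le_r i) h

theorem eval_sub (φ ψ : StepFunction) (u : ℝ) : (φ.sub ψ).eval u = φ.eval u - ψ.eval u := by
  refine (Fin.sum_univ_add _).trans ?_
  simp [eval, sub, sub_eq_add_neg]

theorem integral_sub {Ω : Type*} (φ ψ : StepFunction) (S : ℝ → Ω → ℝ) (ω : Ω) :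
    (φ.sub ψ).integral S ω = φ.integral S ω - ψ.integral S ω := by
  refine (Fin.sum_univ_add _).trans ?_
  simp [integral, sub, sub_eq_add_neg]

theorem eval_shift (φ : StepFunction) (h u : ℝ) : (φ.shift h).eval u = φ.eval (u - h) := by
  simp only [eval, shift]
  refine Finset.sum_congr rfl fun i _ => ?_
  congr 1
  simp only [Set.indicator, Set.mem_Ioc, lt_sub_iff_add_lt, sub_le_iff_le_add]

theorem integrable_indicator_Ioc (l r : ℝ) :
    Integrable ((Set.Ioc l r).indicator fun _ => (1 : ℝ)) volume :=
  memLp_one_iff_integrable.1 (memLp_indicator_const 1 measurableSet_Ioc 1 (Or.inr (by simp)))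

theorem memLp_eval (φ : StepFunction) (p : ℝ≥0∞) : MemLp φ.eval p volume := by
  refine memLp_finsetSum _ fun i _ => MemLp.const_mul ?_ _
  exact memLp_indicator_const p measurableSet_Ioc 1 (Or.inr (by simp))

theorem integral_eval (φ : StepFunction) : ∫ u, φ.eval u = ∑ i, φ.c i * (φ.r i - φ.l i) := by
  simp only [eval]
  rw [integral_finsetSum]
  · refine Finset.sum_congr rfl fun i _ => ?_
    rw [integral_const_mul, integral_indicator_const _ measurableSet_Ioc]
    simp [Measure.real, ENNReal.toReal_ofReal (sub_nonneg.2 (φ.l_le_r i))]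
  · intro i _
    exact (integrable_indicator_Ioc _ _).const_mul _

theorem integral_eval_mul_eval (φ ψ : StepFunction) : ∫ u, φ.eval u * ψ.eval u =
    ∑ i, ∑ j, φ.c i * (ψ.c j * max (min (φ.r i) (ψ.r j) - max (φ.l i) (ψ.l j)) 0) := by
  have e : ∀ u, φ.eval u * ψ.eval u = ∑ i, ∑ j, φ.c i * (ψ.c j *
      (Set.Ioc (max (φ.l i) (ψ.l j)) (min (φ.r i) (ψ.r j))).indicator (fun _ => (1 : ℝ)) u) := by
    intro u
    simp only [eval, Finset.sum_mul_sum]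
    refine Finset.sum_congr rfl fun i _ => Finset.sum_congr rfl fun j _ => ?_
    have h := Set.inter_indicator_mul (s := Set.Ioc (φ.l i) (φ.r i))
      (t := Set.Ioc (ψ.l j) (ψ.r j)) (fun _ => (1 : ℝ)) (fun _ => (1 : ℝ)) u
    simp only [mul_one] at h
    rw [← Set.Ioc_inter_Ioc, h]
    ring
  have hi : ∀ i j, Integrable (fun u => φ.c i * (ψ.c j *
      (Set.Ioc (max (φ.l i) (ψ.l j)) (min (φ.r i) (ψ.r j))).indicator (fun _ => (1 : ℝ)) u)) :=
    fun i j => ((integrable_indicator_Ioc _ _).const_mul _).const_mul _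
  simp_rw [e]
  rw [integral_finsetSum _ fun i _ => integrable_finsetSum _ fun j _ => hi i j]
  refine Finset.sum_congr rfl fun i _ => ?_
  rw [integral_finsetSum _ fun j _ => hi i j]
  refine Finset.sum_congr rfl fun j _ => ?_
  rw [integral_const_mul, integral_const_mul, integral_indicator_const _ measurableSet_Ioc]
  simp [Measure.real, ENNReal.toReal_ofReal']

end StepFunction

theorem MeasureTheory.MemLp.eLpNorm_two_eq {α : Type*} [MeasurableSpace α] {μ : Measure α}
    {f : α → ℝ} (hf : MemLp f 2 μ) : eLpNorm f 2 μ = ENNReal.ofReal (√(∫ x, f x * f x ∂μ)) := by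
  rw [hf.eLpNorm_eq_integral_rpow_norm (by norm_num) (by norm_num), Real.sqrt_eq_rpow]
  congr 2
  · refine integral_congr_ae (Eventually.of_forall fun x => ?_)
    simp [sq]
  · norm_num

namespace IsSquareIntegrableLevy

variable {Ω : Type*} [MeasurableSpace Ω] {P : Measure Ω}
  {S : ℝ → Ω → ℝ} {m v : ℝ}

theorem memLp_stepIntegral (hS : IsSquareIntegrableLevy S P m v) (φ : StepFunction) :
    MemLp (φ.integral S) 2 P :=
  memLp_finsetSum _ fun i _ => ((hS.memLp (φ.r i)).sub (hS.memLp (φ.l i))).const_mul (φ.c i)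

theorem variance_rate_nonneg (hS : IsSquareIntegrableLevy S P m v) : 0 ≤ v := by
  have := hS.variance_increment 0 1
  simp only [sub_zero, abs_one, mul_one] at this
  rw [← this]
  exact variance_nonneg _ _

variable [IsProbabilityMeasure P]

theorem covariance_increment (hS : IsSquareIntegrableLevy S P m v) {l r l' r' : ℝ} (h : l ≤ r)
    (h' : l' ≤ r') :
    covariance (fun ω => S r ω - S l ω) (fun ω => S r' ω - S l' ω) P
      = v * max (min r r' - max l l') 0 := by
  have hc : ∀ x y, covariance (S x) (S y) P
      = (variance (S x) P + variance (S y) P - v * |x - y|) / 2 := by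
    intro x y
    rw [← hS.variance_increment y x, variance_fun_sub (hS.memLp x) (hS.memLp y)]
    ring
  rw [covariance_fun_sub_fun_sub (hS.memLp r) (hS.memLp l) (hS.memLp r') (hS.memLp l')]
  simp only [hc]
  have key : |r - l'| + |l - r'| - |r - r'| - |l - l'| = 2 * max (min r r' - max l l') 0 := by
    grind
  linear_combination (v / 2) * key

theorem integral_stepIntegral (hS : IsSquareIntegrableLevy S P m v) (φ : StepFunction) :
    ∫ ω, φ.integral S ω ∂P = m * ∫ u, φ.eval u := by
  rw [φ.integral_eval, Finset.mul_sum]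
  simp only [StepFunction.integral]
  rw [integral_finsetSum]
  · refine Finset.sum_congr rfl fun i _ => ?_
    rw [integral_const_mul, hS.integral_increment]
    ring
  · exact fun i _ => (((hS.memLp (φ.r i)).sub (hS.memLp (φ.l i))).integrable one_le_two).const_mul _

theorem covariance_stepIntegral (hS : IsSquareIntegrableLevy S P m v) (φ ψ : StepFunction) :
    covariance (φ.integral S) (ψ.integral S) P = v * ∫ u, φ.eval u * ψ.eval u := by
  have hm : ∀ (χ : StepFunction) (i : Fin χ.n),
      MemLp (fun ω => χ.c i * (S (χ.r i) ω - S (χ.l i) ω)) 2 P :=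
    fun χ i => ((hS.memLp (χ.r i)).sub (hS.memLp (χ.l i))).const_mul (χ.c i)
  rw [φ.integral_eval_mul_eval ψ, Finset.mul_sum]
  have e : covariance (φ.integral S) (ψ.integral S) P
      = covariance (fun ω => ∑ i, φ.c i * (S (φ.r i) ω - S (φ.l i) ω))
        (fun ω => ∑ i, ψ.c i * (S (ψ.r i) ω - S (ψ.l i) ω)) P := rfl
  rw [e, covariance_fun_sum_fun_sum (hm φ) (hm ψ)]
  refine Finset.sum_congr rfl fun i _ => ?_
  rw [Finset.mul_sum]
  refine Finset.sum_congr rfl fun j _ => ?_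
  rw [covariance_const_mul_left, covariance_const_mul_right,
    hS.covariance_increment (φ.l_le_r i) (ψ.l_le_r j)]
  ring

theorem eLpNorm_stepIntegral_le (hS : IsSquareIntegrableLevy S P m v) (φ : StepFunction) :
    eLpNorm (φ.integral S) 2 P ≤ ENNReal.ofReal (√v) * eLpNorm φ.eval 2 volume
      + ENNReal.ofReal |m| * eLpNorm φ.eval 1 volume := by
  set e := ∫ ω, φ.integral S ω ∂P with he
  have hφ := hS.memLp_stepIntegral φ
  have e1 : φ.integral S = (fun ω => φ.integral S ω - e) + fun _ => e := by
    ext ω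
    simp
  have hsub : MemLp (fun ω => φ.integral S ω - e) 2 P := hφ.sub (memLp_const e)
  calc eLpNorm (φ.integral S) 2 P
      = eLpNorm ((fun ω => φ.integral S ω - e) + fun _ => e) 2 P := by rw [← e1]
    _ ≤ eLpNorm (fun ω => φ.integral S ω - e) 2 P + eLpNorm (fun _ : Ω => e) 2 P :=
      eLpNorm_add_le hsub.aestronglyMeasurable aestronglyMeasurable_const (by norm_num)
    _ ≤ _ := by
      refine add_le_add (le_of_eq ?_) ?_
      · rw [hsub.eLpNorm_two_eq, (φ.memLp_eval 2).eLpNorm_two_eq,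
          ← ENNReal.ofReal_mul (Real.sqrt_nonneg _), ← Real.sqrt_mul hS.variance_rate_nonneg,
          ← hS.covariance_stepIntegral, covariance]
      · rw [eLpNorm_const _ (by norm_num) (IsProbabilityMeasure.ne_zero P), he,
          hS.integral_stepIntegral, eLpNorm_one_eq_lintegral_enorm]
        simp only [measure_univ, ENNReal.one_rpow, mul_one, enorm_mul]
        gcongr
        · rw [Real.enorm_eq_ofReal_abs]
        · exact enorm_integral_le_lintegral_enorm _

end IsSquareIntegrableLevy

theorem MeasureTheory.tendsto_integral_mul_of_tendsto_eLpNorm_two {α : Type*} [MeasurableSpace α]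
    {μ : Measure α} {F G : ℕ → α → ℝ} {f g : α → ℝ} (hF : ∀ k, MemLp (F k) 2 μ)
    (hG : ∀ k, MemLp (G k) 2 μ) (hf : MemLp f 2 μ) (hg : MemLp g 2 μ)
    (hFf : Tendsto (fun k => eLpNorm (fun x => F k x - f x) 2 μ) atTop (𝓝 0))
    (hGg : Tendsto (fun k => eLpNorm (fun x => G k x - g x) 2 μ) atTop (𝓝 0)) :
    Tendsto (fun k => ∫ x, F k x * G k x ∂μ) atTop (𝓝 (∫ x, f x * g x ∂μ)) := by
  have h1 : Tendsto (fun k => (hF k).toLp (F k)) atTop (𝓝 (hf.toLp f)) :=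
    (Lp.tendsto_Lp_iff_tendsto_eLpNorm'' F hF f hf).2 hFf
  have h2 : Tendsto (fun k => (hG k).toLp (G k)) atTop (𝓝 (hg.toLp g)) :=
    (Lp.tendsto_Lp_iff_tendsto_eLpNorm'' G hG g hg).2 hGg
  have e : ∀ {a b : α → ℝ} (ha : MemLp a 2 μ) (hb : MemLp b 2 μ),
      inner ℝ (ha.toLp a) (hb.toLp b) = ∫ x, a x * b x ∂μ := by
    intro a b ha hb
    rw [L2.inner_def]
    refine integral_congr_ae ?_
    filter_upwards [ha.coeFn_toLp, hb.coeFn_toLp] with x h1 h2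
    rw [h1, h2]
    simp [mul_comm]
  have h := h1.inner (𝕜 := ℝ) h2
  simpa only [e] using h

theorem tendsto_covariance_of_tendsto_eLpNorm_two {Ω : Type*} [MeasurableSpace Ω] {P : Measure Ω}
    [IsProbabilityMeasure P] {F G : ℕ → Ω → ℝ} {f g : Ω → ℝ} (hF : ∀ k, MemLp (F k) 2 P)
    (hG : ∀ k, MemLp (G k) 2 P) (hf : MemLp f 2 P) (hg : MemLp g 2 P)
    (hFf : Tendsto (fun k => eLpNorm (fun x => F k x - f x) 2 P) atTop (𝓝 0))
    (hGg : Tendsto (fun k => eLpNorm (fun x => G k x - g x) 2 P) atTop (𝓝 0)) :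
    Tendsto (fun k => covariance (F k) (G k) P) atTop (𝓝 (covariance f g P)) := by
  have hone : MemLp (fun _ : Ω => (1 : ℝ)) 2 P := memLp_const 1
  have h1 : Tendsto (fun k => eLpNorm (fun x => (fun (_ : ℕ) (_ : Ω) => (1 : ℝ)) k x
      - (fun _ : Ω => (1 : ℝ)) x) 2 P) atTop (𝓝 0) := by simp
  have hmean : ∀ {H : ℕ → Ω → ℝ} {h : Ω → ℝ}, (∀ k, MemLp (H k) 2 P) → MemLp h 2 P →
      Tendsto (fun k => eLpNorm (fun x => H k x - h x) 2 P) atTop (𝓝 0) →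
      Tendsto (fun k => ∫ x, H k x ∂P) atTop (𝓝 (∫ x, h x ∂P)) := by
    intro H h hH hh hHh
    simpa using tendsto_integral_mul_of_tendsto_eLpNorm_two hH (fun _ => hone) hh hone hHh h1
  simp_rw [covariance_eq_sub (hF _) (hG _), covariance_eq_sub hf hg]
  exact (tendsto_integral_mul_of_tendsto_eLpNorm_two hF hG hf hg hFf hGg).sub
    ((hmean hF hf hFf).mul (hmean hG hg hGg))

namespace MeasureTheory

variable {α : Type*} [MeasurableSpace α] {μ : Measure α}

theorem tendsto_eLpNorm_sub_sub {p : ℝ≥0∞} (hp : 1 ≤ p) {F G : ℕ → α → ℝ} {f g : α → ℝ}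
    (hF : ∀ k, AEStronglyMeasurable (F k) μ) (hG : ∀ k, AEStronglyMeasurable (G k) μ)
    (hf : AEStronglyMeasurable f μ) (hg : AEStronglyMeasurable g μ)
    (hFf : Tendsto (fun k => eLpNorm (fun x => F k x - f x) p μ) atTop (𝓝 0))
    (hGg : Tendsto (fun k => eLpNorm (fun x => G k x - g x) p μ) atTop (𝓝 0)) :
    Tendsto (fun k => eLpNorm (fun x => (F k x - G k x) - (f x - g x)) p μ) atTop (𝓝 0) := by
  refine tendsto_of_tendsto_of_tendsto_of_le_of_le tendsto_const_nhds
    (by simpa using hFf.add hGg) (fun _ => zero_le) fun k => ?_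
  have e : (fun x => (F k x - G k x) - (f x - g x))
      = (fun x => F k x - f x) - fun x => G k x - g x := by
    ext x
    simp only [Pi.sub_apply]
    ring
  simp only [e]
  exact eLpNorm_sub_le ((hF k).sub hf) ((hG k).sub hg) hp

end MeasureTheory

namespace IsSquareIntegrableLevy

variable {Ω : Type*} [MeasurableSpace Ω] {P : Measure Ω}
  {S : ℝ → Ω → ℝ} {m v : ℝ}

theorem isStochIntegral_sub (hS : IsSquareIntegrableLevy S P m v) {f g : ℝ → ℝ} {X Y : Ω → ℝ}
    (hX : IsStochIntegral P S f X) (hY : IsStochIntegral P S g Y) :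
    IsStochIntegral P S (fun u => f u - g u) (fun ω => X ω - Y ω) := by
  obtain ⟨hf1, hf2, hXm, φ, h1, h2, h3⟩ := hX
  obtain ⟨hg1, hg2, hYm, ψ, h1', h2', h3'⟩ := hY
  refine ⟨hf1.sub hg1, hf2.sub hg2, hXm.sub hYm, fun k => (φ k).sub (ψ k), ?_, ?_, ?_⟩
  · simp only [StepFunction.eval_sub]
    exact tendsto_eLpNorm_sub_sub le_rfl (fun k => ((φ k).memLp_eval 1).1)
      (fun k => ((ψ k).memLp_eval 1).1) hf1.1 hg1.1 h1 h1'
  · simp only [StepFunction.eval_sub]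
    exact tendsto_eLpNorm_sub_sub one_le_two (fun k => ((φ k).memLp_eval 1).1)
      (fun k => ((ψ k).memLp_eval 1).1) hf1.1 hg1.1 h2 h2'
  · simp only [StepFunction.integral_sub]
    exact tendsto_eLpNorm_sub_sub one_le_two (fun k => (hS.memLp_stepIntegral (φ k)).1)
      (fun k => (hS.memLp_stepIntegral (ψ k)).1) hXm.1 hYm.1 h3 h3'

/-- The increments of the process over finitely many intervals have a translation invariant law. -/
theorem identDistrib_increments_shift (hS : IsSquareIntegrableLevy S P m v) (T : Finset ℝ)
    (h : ℝ) :
    IdentDistrib (fun ω (p : T × T) => S (p.1 + h) ω - S (p.2 + h) ω)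
      (fun ω (p : T × T) => S p.1 ω - S p.2 ω) P P := by
  rcases T.eq_empty_or_nonempty with rfl | hT
  · refine ⟨(measurable_of_subsingleton_codomain _).aemeasurable,
      (measurable_of_subsingleton_codomain _).aemeasurable, ?_⟩
    congr 1
    exact Subsingleton.elim _ _
  obtain ⟨N, hN⟩ := Nat.exists_eq_succ_of_ne_zero hT.card_pos.ne'
  let e := T.orderIsoOfFin hN
  have hmono : Monotone fun i => (e i : ℝ) := fun i j hij => e.monotone hij
  have hmono' : Monotone fun i => (e i : ℝ) + h := fun i j hij => add_le_add_left (hmono hij) h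
  have hV : IdentDistrib
      (fun ω (i : Fin N) => S ((e i.succ : ℝ) + h) ω - S ((e i.castSucc : ℝ) + h) ω)
      (fun ω (i : Fin N) => S (e i.succ) ω - S (e i.castSucc) ω) P P :=
    IdentDistrib.pi (fun i => hS.stationary_increments _ _ h (hmono (Fin.castSucc_le_succ i)))
      (hS.indep_increments N _ hmono') (hS.indep_increments N _ hmono)
  let F : (Fin N → ℝ) → T × T → ℝ := fun x p =>
    ∑ i with i.castSucc < e.symm p.1, x i - ∑ i with i.castSucc < e.symm p.2, x i
  have hF : Measurable F := by fun_prop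
  have hsum : ∀ (y : Fin (N + 1) → ℝ) (k : Fin (N + 1)),
      ∑ i : Fin N with i.castSucc < k, (y i.succ - y i.castSucc) = y k - y 0 := by
    intro y k
    induction k using Fin.induction with
    | zero => simp
    | succ k ih =>
      have : (Finset.univ.filter fun i : Fin N => i.castSucc < k.succ)
          = insert k (Finset.univ.filter fun i : Fin N => i.castSucc < k.castSucc) := by
        ext i
        simp [Fin.castSucc_lt_succ_iff, le_iff_eq_or_lt]
      rw [this, Finset.sum_insert (by simp), ih]
      ring
  have hcomp := hV.comp hF
  convert hcomp using 1
  · ext ω p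
    simp only [F, Function.comp, hsum (fun j => S ((e j : ℝ) + h) ω)]
    simp
  · ext ω p
    simp only [F, Function.comp, hsum (fun j => S (e j : ℝ) ω)]
    simp

theorem identDistrib_stepIntegral_shift (hS : IsSquareIntegrableLevy S P m v) {n : ℕ}
    (φ : Fin n → StepFunction) (h : ℝ) :
    IdentDistrib (fun ω i => ((φ i).shift h).integral S ω) (fun ω i => (φ i).integral S ω) P P := by
  classical
  let T : Finset ℝ := Finset.univ.biUnion fun i : Fin n =>
    (Finset.univ.image (φ i).l) ∪ (Finset.univ.image (φ i).r)
  have hl : ∀ i j, (φ i).l j ∈ T := fun i j => by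
    simp only [T, Finset.mem_biUnion, Finset.mem_union, Finset.mem_image, Finset.mem_univ, true_and]
    exact ⟨i, Or.inl ⟨j, rfl⟩⟩
  have hr : ∀ i j, (φ i).r j ∈ T := fun i j => by
    simp only [T, Finset.mem_biUnion, Finset.mem_union, Finset.mem_image, Finset.mem_univ, true_and]
    exact ⟨i, Or.inr ⟨j, rfl⟩⟩
  exact (hS.identDistrib_increments_shift T h).comp
    (u := fun x i => ∑ j, (φ i).c j * x (⟨(φ i).r j, hr i j⟩, ⟨(φ i).l j, hl i j⟩)) (by fun_prop)

variable [IsProbabilityMeasure P]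

theorem covariance_stochIntegral (hS : IsSquareIntegrableLevy S P m v) {f g : ℝ → ℝ} {X Y : Ω → ℝ}
    (hX : IsStochIntegral P S f X) (hY : IsStochIntegral P S g Y) :
    covariance X Y P = v * ∫ u, f u * g u := by
  obtain ⟨hf1, hf2, hXm, φ, h1, h2, h3⟩ := hX
  obtain ⟨hg1, hg2, hYm, ψ, h1', h2', h3'⟩ := hY
  have hc := tendsto_covariance_of_tendsto_eLpNorm_two (fun k => hS.memLp_stepIntegral (φ k))
    (fun k => hS.memLp_stepIntegral (ψ k)) hXm hYm h3 h3'
  have hi := (tendsto_integral_mul_of_tendsto_eLpNorm_two (fun k => (φ k).memLp_eval 2)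
    (fun k => (ψ k).memLp_eval 2) hf2 hg2 h2 h2').const_mul v
  simp only [hS.covariance_stepIntegral] at hc
  exact tendsto_nhds_unique hc hi

theorem tendsto_eLpNorm_stepIntegral (hS : IsSquareIntegrableLevy S P m v) {ι : Type*}
    {l : Filter ι} {φ : ι → StepFunction}
    (h1 : Tendsto (fun k => eLpNorm (φ k).eval 1 volume) l (𝓝 0))
    (h2 : Tendsto (fun k => eLpNorm (φ k).eval 2 volume) l (𝓝 0)) :
    Tendsto (fun k => eLpNorm ((φ k).integral S) 2 P) l (𝓝 0) := by
  have h := (ENNReal.Tendsto.const_mul (a := ENNReal.ofReal (√v)) h2 (Or.inr (by simp))).add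
    (ENNReal.Tendsto.const_mul (a := ENNReal.ofReal |m|) h1 (Or.inr (by simp)))
  simp only [mul_zero, add_zero] at h
  exact tendsto_of_tendsto_of_tendsto_of_le_of_le tendsto_const_nhds h (fun _ => zero_le)
    fun k => hS.eLpNorm_stepIntegral_le (φ k)

theorem exists_isStochIntegral (hS : IsSquareIntegrableLevy S P m v) {f : ℝ → ℝ}
    (hf1 : MemLp f 1 volume) (hf2 : MemLp f 2 volume) {φ : ℕ → StepFunction}
    (h1 : Tendsto (fun k => eLpNorm (fun u => (φ k).eval u - f u) 1 volume) atTop (𝓝 0))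
    (h2 : Tendsto (fun k => eLpNorm (fun u => (φ k).eval u - f u) 2 volume) atTop (𝓝 0)) :
    ∃ X : Ω → ℝ, IsStochIntegral P S f X := by
  have hmem := fun k => hS.memLp_stepIntegral (φ k)
  have hdiff : ∀ p : ℝ≥0∞, 1 ≤ p → MemLp f p volume →
      Tendsto (fun k => eLpNorm (fun u => (φ k).eval u - f u) p volume) atTop (𝓝 0) →
      Tendsto (fun q : ℕ × ℕ => eLpNorm ((φ q.1).sub (φ q.2)).eval p volume)
        (atTop ×ˢ atTop) (𝓝 0) := by
    intro p hp hf h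
    refine tendsto_of_tendsto_of_tendsto_of_le_of_le tendsto_const_nhds
      (by simpa using (h.comp tendsto_fst).add (h.comp tendsto_snd)) (fun _ => zero_le)
      fun q => ?_
    have e : ((φ q.1).sub (φ q.2)).eval
        = (fun u => (φ q.1).eval u - f u) - fun u => (φ q.2).eval u - f u := by
      ext u
      simp [StepFunction.eval_sub]
    simp only [e]
    exact eLpNorm_sub_le ((((φ q.1).memLp_eval p).sub hf).1) ((((φ q.2).memLp_eval p).sub hf).1) hp
  have hcau : CauchySeq fun k => (hmem k).toLp ((φ k).integral S) := by
    rw [Lp.cauchySeq_Lp_iff_cauchySeq_eLpNorm]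
    have h := hS.tendsto_eLpNorm_stepIntegral (hdiff 1 le_rfl hf1 h1) (hdiff 2 one_le_two hf2 h2)
    rw [prod_atTop_atTop_eq] at h
    refine h.congr fun q => eLpNorm_congr_ae ?_
    filter_upwards [(hmem q.1).coeFn_toLp, (hmem q.2).coeFn_toLp] with ω e1 e2
    rw [Pi.sub_apply, e1, e2, StepFunction.integral_sub]
  obtain ⟨X, hX⟩ := cauchySeq_tendsto_of_complete hcau
  refine ⟨X, hf1, hf2, Lp.memLp X, φ, h1, h2, ?_⟩
  rw [← Lp.toLp_coeFn X (Lp.memLp X)] at hX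
  exact (Lp.tendsto_Lp_iff_tendsto_eLpNorm'' _ hmem _ (Lp.memLp X)).1 hX

end IsSquareIntegrableLevy

theorem MeasureTheory.tendsto_eLpNorm_pi_sub {α : Type*} [MeasurableSpace α] {μ : Measure α}
    {n : ℕ} {F : ℕ → α → Fin n → ℝ} {f : α → Fin n → ℝ}
    (hF : ∀ k i, AEStronglyMeasurable (fun x => F k x i) μ)
    (hf : ∀ i, AEStronglyMeasurable (fun x => f x i) μ)
    (h : ∀ i, Tendsto (fun k => eLpNorm (fun x => F k x i - f x i) 2 μ) atTop (𝓝 0)) :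
    Tendsto (fun k => eLpNorm (F k - f) 2 μ) atTop (𝓝 0) := by
  have hsum := tendsto_finsetSum Finset.univ fun i _ => h i
  simp only [Finset.sum_const_zero] at hsum
  refine tendsto_of_tendsto_of_tendsto_of_le_of_le tendsto_const_nhds hsum (fun _ => zero_le)
    fun k => ?_
  have hmeas : ∀ i, AEStronglyMeasurable (fun x => ‖F k x i - f x i‖) μ :=
    fun i => ((hF k i).sub (hf i)).norm
  calc eLpNorm (F k - f) 2 μ
      ≤ eLpNorm (∑ i, fun x => ‖F k x i - f x i‖) 2 μ := by
        refine eLpNorm_mono_real fun x => ?_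
        rw [Finset.sum_apply]
        refine (pi_norm_le_iff_of_nonneg (Finset.sum_nonneg fun i _ => norm_nonneg _)).2 fun i => ?_
        exact Finset.single_le_sum (f := fun i => ‖F k x i - f x i‖)
          (fun i _ => norm_nonneg _) (Finset.mem_univ i)
    _ ≤ ∑ i, eLpNorm (fun x => ‖F k x i - f x i‖) 2 μ :=
        eLpNorm_sum_le (fun i _ => hmeas i) one_le_two
    _ = ∑ i, eLpNorm (fun x => F k x i - f x i) 2 μ := by simp only [eLpNorm_norm]

theorem MeasureTheory.eLpNorm_comp_sub_right (f : ℝ → ℝ) (hf : AEStronglyMeasurable f volume)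
    (p : ℝ≥0∞) (h : ℝ) : eLpNorm (fun u => f (u - h)) p volume = eLpNorm f p volume :=
  eLpNorm_comp_measurePreserving hf (measurePreserving_sub_right volume h)

/-- Stochastic integrals of translated integrands have the same joint law. -/
theorem IsSquareIntegrableLevy.identDistrib_stochIntegral_shift {Ω : Type*} [MeasurableSpace Ω]
    {P : Measure Ω} [IsProbabilityMeasure P] {S : ℝ → Ω → ℝ} {m v : ℝ}
    (hS : IsSquareIntegrableLevy S P m v) {n : ℕ} {f : Fin n → ℝ → ℝ} {X Y : Fin n → Ω → ℝ} (h : ℝ)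
    (hX : ∀ i, IsStochIntegral P S (f i) (X i))
    (hY : ∀ i, IsStochIntegral P S (fun u => f i (u - h)) (Y i)) :
    IdentDistrib (fun ω i => Y i ω) (fun ω i => X i ω) P P := by
  have hXm := fun i => (hX i).2.2.1
  have hYm := fun i => (hY i).2.2.1
  choose φ hφ1 hφ2 hφ using fun i => (hX i).2.2.2
  choose ψ hψ1 hψ2 hψ using fun i => (hY i).2.2.2
  have hshift : ∀ (p : ℝ≥0∞) (i : Fin n), 1 ≤ p → MemLp (f i) p volume →
      Tendsto (fun k => eLpNorm (fun u => (φ i k).eval u - f i u) p volume) atTop (𝓝 0) →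
      Tendsto (fun k => eLpNorm (fun u => (ψ i k).eval u - f i (u - h)) p volume) atTop (𝓝 0) →
      Tendsto (fun k => eLpNorm (((φ i k).shift h).sub (ψ i k)).eval p volume) atTop (𝓝 0) := by
    intro p i hp hf h1 h2
    have hfs : AEStronglyMeasurable (fun u => f i (u - h)) volume :=
      hf.1.comp_measurePreserving (measurePreserving_sub_right volume h)
    have h1' : Tendsto (fun k => eLpNorm (fun u => ((φ i k).shift h).eval u - f i (u - h)) p volume)
        atTop (𝓝 0) := by
      refine h1.congr fun k => ?_
      simp only [StepFunction.eval_shift]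
      exact (eLpNorm_comp_sub_right (fun u => (φ i k).eval u - f i u)
        (((φ i k).memLp_eval p).1.sub hf.1) p h).symm
    have := tendsto_eLpNorm_sub_sub hp (fun k => (((φ i k).shift h).memLp_eval p).1)
      (fun k => ((ψ i k).memLp_eval p).1) hfs hfs h1' h2
    simp only [sub_self, sub_zero, ← StepFunction.eval_sub] at this
    exact this
  have hdiff : ∀ i, Tendsto (fun k => eLpNorm ((((φ i k).shift h).sub (ψ i k)).integral S) 2 P)
      atTop (𝓝 0) := fun i => hS.tendsto_eLpNorm_stepIntegral
    (hshift 1 i le_rfl (hX i).1 (hφ1 i) (hψ1 i)) (hshift 2 i one_le_two (hX i).2.1 (hφ2 i) (hψ2 i))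
  have hsY : ∀ i, Tendsto (fun k => eLpNorm (fun ω => ((φ i k).shift h).integral S ω - Y i ω) 2 P)
      atTop (𝓝 0) := by
    intro i
    refine tendsto_of_tendsto_of_tendsto_of_le_of_le tendsto_const_nhds
      (by simpa using (hdiff i).add (hψ i)) (fun _ => zero_le) fun k => ?_
    have e : (fun ω => ((φ i k).shift h).integral S ω - Y i ω)
        = (((φ i k).shift h).sub (ψ i k)).integral S + fun ω => (ψ i k).integral S ω - Y i ω := by
      ext ω
      simp [StepFunction.integral_sub]
    simp only [e]
    exact eLpNorm_add_le (hS.memLp_stepIntegral _).1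
      ((hS.memLp_stepIntegral _).1.sub (hYm i).1) one_le_two
  have hlim : ∀ {χ : Fin n → ℕ → StepFunction} {W : Fin n → Ω → ℝ}, (∀ i, MemLp (W i) 2 P) →
      (∀ i, Tendsto (fun k => eLpNorm (fun ω => (χ i k).integral S ω - W i ω) 2 P) atTop (𝓝 0)) →
      TendstoInDistribution (fun k ω i => (χ i k).integral S ω) atTop (fun ω i => W i ω)
        (fun _ => P) P := by
    intro χ W hW hχ
    have hm : ∀ k, AEMeasurable (fun ω i => (χ i k).integral S ω) P := fun k =>
      aemeasurable_pi_lambda _ fun i => (hS.memLp_stepIntegral (χ i k)).1.aemeasurable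
    have hWm : AEMeasurable (fun ω i => W i ω) P :=
      aemeasurable_pi_lambda _ fun i => (hW i).1.aemeasurable
    exact (tendstoInMeasure_of_tendsto_eLpNorm two_ne_zero (fun k => (hm k).aestronglyMeasurable)
      hWm.aestronglyMeasurable (tendsto_eLpNorm_pi_sub
        (fun k i => (hS.memLp_stepIntegral (χ i k)).1) (fun i => (hW i).1)
        hχ)).tendstoInDistribution hm
  have hlimX := hlim hXm hφ
  have hlimY := hlim (χ := fun i k => (φ i k).shift h) hYm hsY
  have hid := fun k => hS.identDistrib_stepIntegral_shift (fun i => φ i k) h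
  have hlimX' : TendstoInDistribution (fun k ω i => ((φ i k).shift h).integral S ω) atTop
      (fun ω i => X i ω) (fun _ => P) P := by
    refine ⟨hlimY.forall_aemeasurable, hlimX.aemeasurable_limit, hlimX.tendsto.congr fun k => ?_⟩
    exact Subtype.ext (hid k).map_eq.symm
  exact ⟨hlimY.aemeasurable_limit, hlimX.aemeasurable_limit,
    tendstoInDistribution_unique _ hlimY hlimX'⟩

/-- The step function on `(-K, K]` with mesh `1 / K` that interpolates `f` at right endpoints. -/
noncomputable def uniformStep (f : ℝ → ℝ) (K : ℕ) : StepFunction where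
  n := 2 * K * K
  c i := f (-K + ((i : ℕ) + 1) / K)
  l i := -K + (i : ℕ) / K
  r i := -K + ((i : ℕ) + 1) / K
  l_le_r i := by gcongr; linarith

theorem uniformStep_eval_cases (f : ℝ → ℝ) {K : ℕ} (hK : 0 < K) (u : ℝ) :
    ((uniformStep f K).eval u = 0 ∧ (K : ℝ) ≤ |u|) ∨
      ∃ x, |x - u| ≤ 1 / K ∧ (uniformStep f K).eval u = f x := by
  have hK' : (0 : ℝ) < K := Nat.cast_pos.2 hK
  have hmem : ∀ i : ℕ, u ∈ Set.Ioc (-K + (i : ℝ) / K) (-K + ((i : ℝ) + 1) / K)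
      ↔ ⌈(u + K) * K⌉₊ = i + 1 := by
    intro i
    rw [Nat.ceil_eq_iff (Nat.succ_ne_zero i), Set.mem_Ioc]
    push_cast [Nat.add_sub_cancel]
    have e1 : -(K : ℝ) + (i : ℝ) / K < u ↔ (i : ℝ) < (u + K) * K := by
      rw [neg_add_lt_iff_lt_add, div_lt_iff₀ hK', add_comm]
    have e2 : u ≤ -(K : ℝ) + ((i : ℝ) + 1) / K ↔ (u + K) * K ≤ i + 1 := by
      rw [← sub_le_iff_le_add', le_div_iff₀ hK', sub_neg_eq_add]
    rw [e1, e2]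
  have heval : (uniformStep f K).eval u = ∑ i : Fin (2 * K * K),
      if ⌈(u + K) * K⌉₊ = (i : ℕ) + 1 then f (-K + ((i : ℕ) + 1) / K) else 0 := by
    refine Finset.sum_congr rfl fun i _ => ?_
    simp only [uniformStep, Set.indicator, hmem, mul_ite, mul_one, mul_zero]
  by_cases hu : ∃ i : Fin (2 * K * K), ⌈(u + K) * K⌉₊ = (i : ℕ) + 1
  · right
    obtain ⟨i, hi⟩ := hu
    refine ⟨-K + ((i : ℕ) + 1) / K, ?_, ?_⟩
    · obtain ⟨h1, h2⟩ := (hmem i).2 hi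
      rw [abs_of_nonneg (by linarith)]
      have : ((i : ℕ) + 1 : ℝ) / K = (i : ℕ) / K + 1 / K := add_div _ _ _
      linarith
    · rw [heval, Finset.sum_eq_single i]
      · rw [if_pos hi]
      · intro j _ hj
        rw [if_neg]
        rw [hi]
        intro h
        exact hj (Fin.ext (Nat.succ_injective h).symm)
      · simp
  · left
    push Not at hu
    refine ⟨?_, ?_⟩
    · rw [heval]
      exact Finset.sum_eq_zero fun i _ => if_neg (hu i)
    · by_contra! hlt
      obtain ⟨h1, h2⟩ := abs_lt.1 hlt
      have hpos : 0 < ⌈(u + K) * K⌉₊ := Nat.ceil_pos.2 (mul_pos (by linarith) hK')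
      have hle : ⌈(u + K) * K⌉₊ ≤ 2 * K * K := by
        refine Nat.ceil_le.2 ?_
        push_cast
        gcongr
        linarith
      exact hu ⟨⌈(u + K) * K⌉₊ - 1, by omega⟩ (by simp only; omega)

theorem tendsto_uniformStep_eval {f : ℝ → ℝ} (hf : Continuous f) (u : ℝ) :
    Tendsto (fun k : ℕ => (uniformStep f (k + 1)).eval u) atTop (𝓝 (f u)) := by
  rw [Metric.tendsto_atTop]
  intro ε hε
  obtain ⟨δ, hδ, hfδ⟩ := Metric.continuous_iff.1 hf u ε hε
  obtain ⟨N, hN⟩ := exists_nat_gt (max |u| (1 / δ))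
  refine ⟨N, fun k hk => ?_⟩
  have hNk : (N : ℝ) ≤ k := Nat.cast_le.2 hk
  have h1 := (le_max_left _ _).trans_lt hN
  have h2 := (le_max_right _ _).trans_lt hN
  rcases uniformStep_eval_cases f k.succ_pos u with ⟨-, h⟩ | ⟨x, hx, h⟩
  · push_cast at h
    linarith
  · rw [h]
    refine hfδ x ?_
    rw [Real.dist_eq]
    refine hx.trans_lt ?_
    push_cast
    rw [div_lt_iff₀ (by positivity)]
    rw [div_lt_iff₀ hδ] at h2
    nlinarith

theorem abs_uniformStep_eval_le {f : ℝ → ℝ} {C p : ℝ} (hC : 0 ≤ C) (hp : 0 ≤ p)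
    (hf : ∀ u, |f u| ≤ C * (1 + ‖u‖) ^ (-p)) (k : ℕ) (u : ℝ) :
    |(uniformStep f (k + 1)).eval u| ≤ C * 2 ^ p * (1 + ‖u‖) ^ (-p) := by
  rcases uniformStep_eval_cases f k.succ_pos u with ⟨h, -⟩ | ⟨x, hx, h⟩
  · rw [h, abs_zero]
    positivity
  · rw [h, mul_assoc]
    refine (hf x).trans (mul_le_mul_of_nonneg_left ?_ hC)
    have hx1 : |x - u| ≤ 1 := hx.trans (by
      rw [div_le_one (by positivity)]
      push_cast
      linarith [Nat.cast_nonneg (α := ℝ) k])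
    have hle : (1 + ‖u‖) / 2 ≤ 1 + ‖x‖ := by
      rw [Real.norm_eq_abs, Real.norm_eq_abs]
      have := abs_sub_abs_le_abs_sub u x
      rw [abs_sub_comm] at this
      linarith [abs_nonneg x]
    calc (1 + ‖x‖) ^ (-p) ≤ ((1 + ‖u‖) / 2) ^ (-p) :=
          Real.rpow_le_rpow_of_nonpos (by positivity) hle (by linarith)
      _ = 2 ^ p * (1 + ‖u‖) ^ (-p) := by
          rw [Real.div_rpow (by positivity) zero_le_two, Real.rpow_neg zero_le_two, div_inv_eq_mul,
            mul_comm]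

theorem memLp_one_add_norm_rpow {p : ℝ} (hp : 1 < p) {q : ℝ≥0∞} (hq : q = 1 ∨ q = 2) :
    MemLp (fun u : ℝ => (1 + ‖u‖) ^ (-p)) q volume := by
  rcases hq with rfl | rfl
  · rw [memLp_one_iff_integrable]
    exact integrable_one_add_norm (by simpa using hp)
  · rw [memLp_two_iff_integrable_sq (Measurable.aestronglyMeasurable (by fun_prop))]
    have h : Integrable (fun u : ℝ => (1 + ‖u‖) ^ (-(p * 2))) volume :=
      integrable_one_add_norm (by simp; linarith)
    refine h.congr (Eventually.of_forall fun u => ?_)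
    simp only
    rw [← Real.rpow_natCast, ← Real.rpow_mul (by positivity)]
    norm_num

theorem MeasureTheory.tendsto_eLpNorm_zero_of_dominated {α : Type*} [MeasurableSpace α]
    {μ : Measure α} {q : ℝ≥0∞} (hq0 : q ≠ 0) (hq : q ≠ ∞) {F : ℕ → α → ℝ} {B : α → ℝ}
    (hF : ∀ k, AEStronglyMeasurable (F k) μ) (hB : MemLp B q μ) (hFB : ∀ k x, |F k x| ≤ B x)
    (hlim : ∀ x, Tendsto (fun k => F k x) atTop (𝓝 0)) :
    Tendsto (fun k => eLpNorm (F k) q μ) atTop (𝓝 0) := by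
  have hqpos : 0 < q.toReal := ENNReal.toReal_pos hq0 hq
  simp_rw [eLpNorm_eq_lintegral_rpow_enorm_toReal hq0 hq]
  have h : Tendsto (fun k => ∫⁻ x, ‖F k x‖ₑ ^ q.toReal ∂μ) atTop (𝓝 (∫⁻ _, 0 ∂μ)) := by
    refine tendsto_lintegral_of_dominated_convergence' (fun x => ‖B x‖ₑ ^ q.toReal)
      (fun k => (hF k).enorm.pow_const _) (fun k => Eventually.of_forall fun x => ?_) ?_
      (Eventually.of_forall fun x => ?_)
    · refine ENNReal.rpow_le_rpow ?_ hqpos.le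
      rw [enorm_le_iff_norm_le]
      exact (hFB k x).trans (le_abs_self _)
    · exact (lintegral_rpow_enorm_lt_top_of_eLpNorm_lt_top hq0 hq hB.2).ne
    · have h := (ENNReal.continuous_rpow_const (y := q.toReal)).tendsto 0 |>.comp
        (by simpa using (hlim x).enorm)
      rwa [ENNReal.zero_rpow_of_pos hqpos] at h
  have h' := (ENNReal.continuous_rpow_const (y := 1 / q.toReal)).tendsto _ |>.comp h
  rwa [lintegral_zero, ENNReal.zero_rpow_of_pos (by positivity)] at h'

theorem IsSquareIntegrableLevy.exists_isStochIntegral_of_le {Ω : Type*} [MeasurableSpace Ω]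
    {P : Measure Ω} [IsProbabilityMeasure P] {S : ℝ → Ω → ℝ} {m v : ℝ}
    (hS : IsSquareIntegrableLevy S P m v) {f : ℝ → ℝ} (hf : Continuous f) {C p : ℝ} (hC : 0 ≤ C)
    (hp : 1 < p) (hfC : ∀ u, |f u| ≤ C * (1 + ‖u‖) ^ (-p)) :
    ∃ X : Ω → ℝ, IsStochIntegral P S f X := by
  have hmem : ∀ q : ℝ≥0∞, q = 1 ∨ q = 2 → MemLp f q volume := fun q hq =>
    ((memLp_one_add_norm_rpow hp hq).const_mul C).mono' hf.aestronglyMeasurable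
      (Eventually.of_forall hfC)
  have hlim : ∀ q : ℝ≥0∞, q = 1 ∨ q = 2 → Tendsto
      (fun k : ℕ => eLpNorm (fun u => (uniformStep f (k + 1)).eval u - f u) q volume)
      atTop (𝓝 0) := by
    intro q hq
    refine tendsto_eLpNorm_zero_of_dominated (by rcases hq with rfl | rfl <;> norm_num)
      (by rcases hq with rfl | rfl <;> norm_num)
      (fun k => ((uniformStep f (k + 1)).memLp_eval q).1.sub hf.aestronglyMeasurable)
      ((memLp_one_add_norm_rpow hp hq).const_mul (C * 2 ^ p + C)) (fun k u => ?_) fun u => ?_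
    · rw [add_mul]
      exact (abs_sub _ _).trans
        (add_le_add (abs_uniformStep_eval_le hC (by linarith) hfC k u) (hfC u))
    · simpa using (tendsto_uniformStep_eval hf u).sub_const (f u)
  exact hS.exists_isStochIntegral (hmem 1 (Or.inl rfl)) (hmem 2 (Or.inr rfl)) (hlim 1 (Or.inl rfl))
    (hlim 2 (Or.inr rfl))

theorem Real.rpow_add_mul_sub_le_rpow {x y d : ℝ} (hx : 0 < x) (hy : 0 < y) (hd : d ≤ 0) :
    x ^ d + d * x ^ (d - 1) * (y - x) ≤ y ^ d := by
  have hlog := Real.log_le_sub_one_of_pos (div_pos hy hx)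
  have h1 : 1 + d * (y / x - 1) ≤ (y / x) ^ d := by
    rw [Real.rpow_def_of_pos (div_pos hy hx)]
    nlinarith [Real.add_one_le_exp (Real.log (y / x) * d)]
  rw [Real.div_rpow hy.le hx.le, le_div_iff₀ (Real.rpow_pos_of_pos hx d)] at h1
  calc x ^ d + d * x ^ (d - 1) * (y - x) = (1 + d * (y / x - 1)) * x ^ d := by
        rw [Real.rpow_sub_one hx.ne']
        field_simp
    _ ≤ y ^ d := h1

section ShiftedPower

variable {a d : ℝ}

theorem shiftedPower_base_pos (ha : 0 < a) (x : ℝ) : 0 < a + max x 0 :=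
  add_pos_of_pos_of_nonneg ha (le_max_right _ _)

theorem continuous_shiftedPower (ha : 0 < a) (d : ℝ) : Continuous (shiftedPower a d) :=
  Continuous.rpow_const (by fun_prop) fun x => Or.inl (shiftedPower_base_pos ha x).ne'

theorem shiftedPower_pos (ha : 0 < a) (x : ℝ) : 0 < shiftedPower a d x :=
  Real.rpow_pos_of_pos (shiftedPower_base_pos ha x) d

theorem shiftedPower_antitone (ha : 0 < a) (hd : d ≤ 0) : Antitone (shiftedPower a d) :=
  fun x _ hxy => Real.rpow_le_rpow_of_nonpos (shiftedPower_base_pos ha x)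
    (by gcongr) hd

theorem shiftedPower_sub_le (ha : 0 < a) (hd : d ≤ 0) {x y : ℝ} (hxy : x ≤ y) :
    shiftedPower a d x - shiftedPower a d y ≤ -d * (y - x) * (a + max x 0) ^ (d - 1) := by
  have h := Real.rpow_add_mul_sub_le_rpow (shiftedPower_base_pos ha x)
    (shiftedPower_base_pos ha y) hd
  have h2 : (a + max y 0) - (a + max x 0) ≤ y - x := by
    have := abs_max_sub_max_le_abs y x 0
    rw [abs_of_nonneg (sub_nonneg.2 hxy)] at this
    linarith [le_abs_self (max y 0 - max x 0)]
  have h3 : 0 ≤ -d * (a + max x 0) ^ (d - 1) :=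
    mul_nonneg (by linarith) (Real.rpow_nonneg (shiftedPower_base_pos ha x).le _)
  have h4 := mul_le_mul_of_nonneg_left h2 h3
  simp only [shiftedPower]
  linarith

theorem le_shiftedPower_sub (ha : 0 < a) (hd : d ≤ 0) {x y : ℝ} (hx : 0 ≤ x) (hxy : x ≤ y) :
    -d * (y - x) * (a + y) ^ (d - 1) ≤ shiftedPower a d x - shiftedPower a d y := by
  have h := Real.rpow_add_mul_sub_le_rpow (shiftedPower_base_pos ha y)
    (shiftedPower_base_pos ha x) hd
  simp only [shiftedPower]
  rw [max_eq_left hx, max_eq_left (hx.trans hxy)] at *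
  linarith

theorem continuous_modMvNKernel (ha : 0 < a) (d t : ℝ) : Continuous (modMvNKernel a d t) :=
  ((continuous_shiftedPower ha d).comp (by fun_prop)).sub
    ((continuous_shiftedPower ha d).comp (by fun_prop))

theorem exists_abs_modMvNKernel_le (ha : 0 < a) (hd : d ≤ 0) (t : ℝ) :
    ∃ C, 0 ≤ C ∧ ∀ u, |modMvNKernel a d t u| ≤ C * (1 + ‖u‖) ^ (-(1 - d)) := by
  set b := min 1 a / (1 + 2 * |t|) with hb
  have hmin : 0 < min 1 a := lt_min one_pos ha
  have hbpos : 0 < b := by positivity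
  have hb1 : b ≤ 1 := by
    rw [hb, div_le_one (by positivity)]
    linarith [min_le_left 1 a, abs_nonneg t]
  have hbt : b * (1 + 2 * |t|) = min 1 a := by
    rw [hb]
    field_simp
  have ht := neg_abs_le t
  have ht' := le_abs_self t
  refine ⟨-d * |t| * b ^ (d - 1), mul_nonneg (mul_nonneg (by linarith) (abs_nonneg t))
    (Real.rpow_nonneg hbpos.le _), fun u => ?_⟩
  have hR : 0 ≤ -d * |t| * b ^ (d - 1) * (1 + ‖u‖) ^ (-(1 - d)) :=
    mul_nonneg (mul_nonneg (mul_nonneg (by linarith) (abs_nonneg t))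
      (Real.rpow_nonneg hbpos.le _)) (by positivity)
  rcases le_or_gt |t| u with hu | hu
  · have e : modMvNKernel a d t u = 0 := by
      simp only [modMvNKernel, shiftedPower]
      rw [max_eq_right (by linarith [abs_nonneg t]), max_eq_right (by linarith), sub_self]
    rw [e, abs_zero]
    exact hR
  have hbase : ∀ x, -|t| - u ≤ x → b * (1 + ‖u‖) ≤ a + max x 0 := by
    intro x hx
    have h1 := le_max_left x 0
    have h2 := le_max_right x 0
    have h3 : ‖u‖ - 2 * |t| ≤ max x 0 := by
      rw [Real.norm_eq_abs]
      rcases abs_cases u with ⟨e, _⟩ | ⟨e, _⟩ <;> linarith [abs_nonneg t]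
    have h4 := min_le_right 1 a
    rcases le_total ‖u‖ (2 * |t|) with h | h
    · nlinarith
    · nlinarith
  have hgen : ∀ x y, x ≤ y → y - x = |t| → -|t| - u ≤ x →
      |shiftedPower a d x - shiftedPower a d y|
        ≤ -d * |t| * b ^ (d - 1) * (1 + ‖u‖) ^ (-(1 - d)) := by
    intro x y hxy hyx hx
    rw [abs_of_nonneg (sub_nonneg.2 (shiftedPower_antitone ha hd hxy))]
    refine (shiftedPower_sub_le ha hd hxy).trans ?_
    rw [hyx, mul_assoc (-d * |t|), neg_sub, ← Real.mul_rpow hbpos.le (by positivity)]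
    refine mul_le_mul_of_nonneg_left ?_ (mul_nonneg (by linarith) (abs_nonneg t))
    exact Real.rpow_le_rpow_of_nonpos (by positivity) (hbase x hx) (by linarith)
  rcases le_total 0 t with h0 | h0
  · exact hgen (-u) (t - u) (by linarith) (by rw [abs_of_nonneg h0]; ring)
      (by linarith [abs_nonneg t])
  · rw [modMvNKernel, abs_sub_comm]
    exact hgen (t - u) (-u) (by linarith) (by rw [abs_of_nonpos h0]; ring) (by linarith)

theorem integrable_modMvNKernel (ha : 0 < a) (hd : d < 0) (t : ℝ) :
    Integrable (modMvNKernel a d t) := by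
  obtain ⟨C, -, h⟩ := exists_abs_modMvNKernel_le ha hd.le t
  exact ((memLp_one_iff_integrable.1 (memLp_one_add_norm_rpow (p := 1 - d) (by linarith)
    (Or.inl rfl))).const_mul C).mono' (continuous_modMvNKernel ha d t).aestronglyMeasurable
    (Eventually.of_forall h)

/-- The decrement `g(x) - g(x + r)` of the shifted power `g`. -/
noncomputable def shiftedPowerDecr (a d r x : ℝ) : ℝ := shiftedPower a d x - shiftedPower a d (x + r)

theorem modMvNKernel_sub (a d s t u : ℝ) :
    modMvNKernel a d t u - modMvNKernel a d s u = shiftedPowerDecr a d (t - s) (s - u) := by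
  simp only [modMvNKernel, shiftedPowerDecr]
  rw [show s - u + (t - s) = t - u by ring]
  ring

theorem shiftedPowerDecr_nonneg (ha : 0 < a) (hd : d ≤ 0) {r : ℝ} (hr : 0 ≤ r) (x : ℝ) :
    0 ≤ shiftedPowerDecr a d r x :=
  sub_nonneg.2 (shiftedPower_antitone ha hd (by linarith))

theorem continuous_shiftedPowerDecr (ha : 0 < a) (d r : ℝ) :
    Continuous (shiftedPowerDecr a d r) :=
  (continuous_shiftedPower ha d).sub ((continuous_shiftedPower ha d).comp (by fun_prop))

theorem integrable_shiftedPowerDecr (ha : 0 < a) (hd : d < 0) (r : ℝ) :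
    Integrable (shiftedPowerDecr a d r) := by
  refine (integrable_modMvNKernel ha hd r).comp_neg.congr (Eventually.of_forall fun x => ?_)
  simp only [modMvNKernel, shiftedPowerDecr, neg_neg, sub_neg_eq_add, add_comm]

theorem integral_shiftedPowerDecr (ha : 0 < a) (hd : d < 0) {r : ℝ} (hr : 0 < r) :
    ∫ x, shiftedPowerDecr a d r x = r * a ^ d := by
  have hint : ∀ x y, IntervalIntegrable (shiftedPower a d) volume x y := fun x y =>
    (continuous_shiftedPower ha d).intervalIntegrable x y
  have hlim := intervalIntegral_tendsto_integral (integrable_shiftedPowerDecr ha hd r)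
    (tendsto_neg_atTop_atBot (G := ℝ)) tendsto_id
  refine tendsto_nhds_unique hlim ?_
  have e : (fun R : ℝ => r * a ^ d - ∫ x in R..(R + r), shiftedPower a d x)
      =ᶠ[atTop] fun R => ∫ x in (-R)..R, shiftedPowerDecr a d r x := by
    filter_upwards [eventually_ge_atTop r] with R hR
    simp only [shiftedPowerDecr]
    have hint' : IntervalIntegrable (fun x => shiftedPower a d (x + r)) volume (-R) R :=
      ((continuous_shiftedPower ha d).comp (continuous_add_const r)).intervalIntegrable _ _
    rw [intervalIntegral.integral_sub (hint _ _) hint',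
      intervalIntegral.integral_comp_add_right (shiftedPower a d) r,
      intervalIntegral.integral_interval_sub_interval_comm (hint _ _) (hint _ _) (hint _ _)]
    congr 1
    have hc : ∫ x in (-R)..(-R + r), shiftedPower a d x = ∫ _ in (-R)..(-R + r), a ^ d := by
      refine intervalIntegral.integral_congr fun x hx => ?_
      rw [Set.uIcc_of_le (by linarith)] at hx
      simp only [shiftedPower]
      rw [max_eq_right (by linarith [hx.2]), add_zero]
    rw [hc, intervalIntegral.integral_const]
    simp
  refine Tendsto.congr' e ?_
  have htail : Tendsto (fun R : ℝ => ∫ x in R..(R + r), shiftedPower a d x) atTop (𝓝 0) := by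
    have hg : Tendsto (fun R : ℝ => r * (a + R) ^ d) atTop (𝓝 0) := by
      have h := (tendsto_rpow_neg_atTop (y := -d) (by linarith)).comp
        (tendsto_atTop_add_const_left atTop a tendsto_id)
      simpa [Function.comp_def] using h.const_mul r
    refine tendsto_of_tendsto_of_tendsto_of_le_of_le' tendsto_const_nhds hg ?_ ?_
    · exact Eventually.of_forall fun R => intervalIntegral.integral_nonneg (by linarith)
        fun x _ => (shiftedPower_pos ha x).le
    · filter_upwards [eventually_ge_atTop 0] with R hR
      have h := intervalIntegral.integral_mono_on (by linarith : R ≤ R + r) (hint R (R + r))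
        (intervalIntegrable_const (c := (a + R) ^ d)) fun x hx => by
          have := shiftedPower_antitone ha hd.le hx.1
          rwa [shiftedPower, shiftedPower, max_eq_left hR] at this
      rw [intervalIntegral.integral_const] at h
      simpa using h
  simpa using htail.const_sub (r * a ^ d)

theorem tendsto_add_rpow_div_rpow (c₁ c₂ p : ℝ) :
    Tendsto (fun T : ℝ => (T + c₁) ^ p / (T + c₂) ^ p) atTop (𝓝 1) := by
  have h1 : Tendsto (fun T : ℝ => (T + c₁) / (T + c₂)) atTop (𝓝 1) := by
    have h : Tendsto (fun T : ℝ => 1 + (c₁ - c₂) / (T + c₂)) atTop (𝓝 (1 + 0)) :=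
      tendsto_const_nhds.add ((tendsto_const_nhds (x := c₁ - c₂)).div_atTop
        (tendsto_atTop_add_const_right atTop c₂ tendsto_id))
    rw [add_zero] at h
    refine h.congr' ?_
    filter_upwards [eventually_gt_atTop (-c₂)] with T hT
    have : T + c₂ ≠ 0 := by linarith
    field_simp
    ring
  have h2 := h1.rpow_const (p := p) (Or.inl one_ne_zero)
  rw [Real.one_rpow] at h2
  refine h2.congr' ?_
  filter_upwards [eventually_ge_atTop (-c₁), eventually_ge_atTop (-c₂)] with T hT1 hT2
  rw [Real.div_rpow (by linarith) (by linarith)]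

theorem tendsto_shiftedPowerDecr_div (ha : 0 < a) (hd : d ≤ 0) {r : ℝ} (hr : 0 ≤ r) (x : ℝ) :
    Tendsto (fun T => shiftedPowerDecr a d r (x + T) / (T + a) ^ (d - 1)) atTop (𝓝 (-d * r)) := by
  have hlow := (tendsto_add_rpow_div_rpow (a + x + r) a (d - 1)).const_mul (-d * r)
  have hup := (tendsto_add_rpow_div_rpow (a + x) a (d - 1)).const_mul (-d * r)
  rw [mul_one] at hlow hup
  refine tendsto_of_tendsto_of_tendsto_of_le_of_le' hlow hup ?_ ?_
  · filter_upwards [eventually_ge_atTop (-x), eventually_ge_atTop 0] with T hT hT0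
    rw [← mul_div_assoc]
    refine div_le_div_of_nonneg_right ?_ (Real.rpow_nonneg (by linarith) _)
    have h := le_shiftedPower_sub ha hd (by linarith : 0 ≤ x + T)
      (by linarith : x + T ≤ x + T + r)
    rw [add_sub_cancel_left] at h
    rwa [show T + (a + x + r) = a + (x + T + r) by ring]
  · filter_upwards [eventually_ge_atTop (-x), eventually_ge_atTop 0] with T hT hT0
    rw [← mul_div_assoc]
    refine div_le_div_of_nonneg_right ?_ (Real.rpow_nonneg (by linarith) _)
    have h := shiftedPower_sub_le ha hd (by linarith : x + T ≤ x + T + r)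
    rw [max_eq_left (by linarith : 0 ≤ x + T)] at h
    rw [add_sub_cancel_left] at h
    rwa [show T + (a + x) = a + (x + T) by ring]

theorem tendsto_integral_shiftedPowerDecr (ha : 0 < a) (hd : d < 0) {r : ℝ} (hr : 0 < r) :
    Tendsto (fun T => (∫ x, shiftedPowerDecr a d r (x + T) * shiftedPowerDecr a d r x)
      / (T + a) ^ (d - 1)) atTop (𝓝 (-d * a ^ d * r ^ 2)) := by
  have hw := integrable_shiftedPowerDecr ha hd r
  have hwc := continuous_shiftedPowerDecr ha d r
  have hlimval : -d * a ^ d * r ^ 2 = ∫ x, -d * r * shiftedPowerDecr a d r x := by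
    rw [integral_const_mul, integral_shiftedPowerDecr ha hd hr]
    ring
  rw [hlimval]
  have e : ∀ T, (∫ x, shiftedPowerDecr a d r (x + T) * shiftedPowerDecr a d r x)
      / (T + a) ^ (d - 1) = ∫ x, shiftedPowerDecr a d r (x + T) / (T + a) ^ (d - 1)
        * shiftedPowerDecr a d r x := by
    intro T
    rw [← integral_div]
    refine integral_congr_ae (Eventually.of_forall fun x => ?_)
    simp only
    ring
  simp_rw [e]
  refine tendsto_integral_filter_of_dominated_convergence
    (fun x => -d * r * 2 ^ (1 - d) * shiftedPowerDecr a d r x) ?_ ?_ (hw.const_mul _) ?_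
  · refine Eventually.of_forall fun T => Continuous.aestronglyMeasurable ?_
    exact ((hwc.comp (continuous_add_const T)).div_const _).mul hwc
  · filter_upwards [eventually_ge_atTop (2 * r)] with T hT
    refine Eventually.of_forall fun x => ?_
    have hw0 := shiftedPowerDecr_nonneg ha hd.le hr.le
    rcases lt_or_ge x (-r) with hx | hx
    · have hzero : shiftedPowerDecr a d r x = 0 := by
        simp only [shiftedPowerDecr, shiftedPower]
        rw [max_eq_right (by linarith), max_eq_right (by linarith), sub_self]
      simp [hzero]
    · have hTa : 0 < (T + a) ^ (d - 1) := Real.rpow_pos_of_pos (by linarith) _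
      rw [Real.norm_of_nonneg (mul_nonneg (div_nonneg (hw0 _) hTa.le) (hw0 _))]
      refine mul_le_mul_of_nonneg_right ?_ (hw0 x)
      rw [div_le_iff₀ hTa]
      have h := shiftedPower_sub_le ha hd.le (by linarith : x + T ≤ x + T + r)
      have h2 : (a + max (x + T) 0) ^ (d - 1) ≤ 2 ^ (1 - d) * (T + a) ^ (d - 1) := by
        calc (a + max (x + T) 0) ^ (d - 1) ≤ ((T + a) / 2) ^ (d - 1) :=
              Real.rpow_le_rpow_of_nonpos (by linarith)
                (by linarith [le_max_left (x + T) 0]) (by linarith)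
          _ = 2 ^ (1 - d) * (T + a) ^ (d - 1) := by
              rw [Real.div_rpow (by linarith) zero_le_two, ← neg_sub d 1,
                Real.rpow_neg zero_le_two, inv_mul_eq_div]
      refine h.trans ?_
      rw [add_sub_cancel_left, mul_assoc (-d * r)]
      exact mul_le_mul_of_nonneg_left h2 (mul_nonneg (by linarith) hr.le)
  · exact Eventually.of_forall fun x =>
      (tendsto_shiftedPowerDecr_div ha hd.le hr.le x).mul_const _

end ShiftedPower

section ModMvN

variable {Ω : Type*} [MeasurableSpace Ω] {P : Measure Ω} {S : ℝ → Ω → ℝ}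
  {m v a d : ℝ} {Z : ℝ → Ω → ℝ}

theorem IsModMvNSubordinator.increment (hZ : IsModMvNSubordinator P S a d Z)
    (hS : IsSquareIntegrableLevy S P m v) (s t : ℝ) :
    IsStochIntegral P S (fun u => shiftedPowerDecr a d (t - s) (s - u))
      (fun ω => Z t ω - Z s ω) := by
  simp only [← modMvNKernel_sub]
  exact hS.isStochIntegral_sub (hZ t) (hZ s)

variable [IsProbabilityMeasure P]

theorem IsSquareIntegrableLevy.exists_isModMvNSubordinator (hS : IsSquareIntegrableLevy S P m v)
    (ha : 0 < a) (hd : d < 0) : ∃ Z : ℝ → Ω → ℝ, IsModMvNSubordinator P S a d Z := by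
  have h : ∀ t, ∃ X : Ω → ℝ, IsStochIntegral P S (modMvNKernel a d t) X := by
    intro t
    obtain ⟨C, hC, hle⟩ := exists_abs_modMvNKernel_le ha hd.le t
    exact hS.exists_isStochIntegral_of_le (continuous_modMvNKernel ha d t) hC (by linarith) hle
  choose Z hZ using h
  exact ⟨Z, hZ⟩

theorem IsModMvNSubordinator.hasStationaryIncrements (hZ : IsModMvNSubordinator P S a d Z)
    (hS : IsSquareIntegrableLevy S P m v) : HasStationaryIncrements Z P := by
  intro h n t _
  refine hS.identDistrib_stochIntegral_shift h
    (X := fun i ω => Z (t i.succ) ω - Z (t i.castSucc) ω)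
    (Y := fun i ω => Z (t i.succ + h) ω - Z (t i.castSucc + h) ω)
    (fun i => hZ.increment hS (t i.castSucc) (t i.succ)) fun i => ?_
  have h' := hZ.increment hS (t i.castSucc + h) (t i.succ + h)
  simp only [add_sub_add_right_eq_sub] at h'
  convert h' using 3
  ring

theorem IsModMvNSubordinator.covariance_increments (hZ : IsModMvNSubordinator P S a d Z)
    (hS : IsSquareIntegrableLevy S P m v) (r h s : ℝ) :
    covariance (fun ω => Z (s + (h + 1) * r) ω - Z (s + h * r) ω)
      (fun ω => Z (s + r) ω - Z s ω) P
      = v * ∫ x, shiftedPowerDecr a d r (x + h * r) * shiftedPowerDecr a d r x := by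
  rw [hS.covariance_stochIntegral (hZ.increment hS _ _) (hZ.increment hS _ _),
    ← integral_sub_left_eq_self
      (fun x => shiftedPowerDecr a d r (x + h * r) * shiftedPowerDecr a d r x) volume s]
  congr 2
  ext u
  ring_nf

end ModMvN

theorem mainTheorem2 {Ω : Type*} [MeasurableSpace Ω] (P : Measure Ω) [IsProbabilityMeasure P]
    (S : ℝ → Ω → ℝ) (hS : IsTwoSidedSubordinator S P) (hS2 : MemLp (S 1) 2 P)
    (a d : ℝ) (ha : 0 < a) (hd : d ∈ Set.Ioo (-(1 / 2) : ℝ) 0) :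
    (∃ Z : ℝ → Ω → ℝ, IsModMvNSubordinator P S a d Z) ∧
    ∀ Z : ℝ → Ω → ℝ, IsModMvNSubordinator P S a d Z →
      HasStationaryIncrements Z P ∧
      ∀ r : ℝ, 0 < r →
        ∃ γ : ℝ → ℝ,
          (∀ h : ℝ, 0 < h → ∀ s : ℝ,
            covariance (fun ω => Z (s + (h + 1) * r) ω - Z (s + h * r) ω)
              (fun ω => Z (s + r) ω - Z s ω) P = γ h) ∧
          (γ ~[atTop] fun h : ℝ =>
            variance (S 1) P * |d| * a ^ d * r ^ 2 * (h * r + a) ^ (d - 1)) ∧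
          (0 < variance (S 1) P →
            (∀ᶠ h in atTop, 0 < γ h) ∧ γ =Θ[atTop] fun h : ℝ => h ^ (d - 1)) := by
  have hL := hS.isSquareIntegrableLevy hS2
  have hd0 : d < 0 := hd.2
  refine ⟨hL.exists_isModMvNSubordinator ha hd0, fun Z hZ =>
    ⟨hZ.hasStationaryIncrements hL, fun r hr => ?_⟩⟩
  set v := variance (S 1) P
  set J : ℝ → ℝ := fun T => ∫ x, shiftedPowerDecr a d r (x + T) * shiftedPowerDecr a d r x
  refine ⟨fun h => v * J (h * r), fun h _ s => hZ.covariance_increments hL r h s, ?_⟩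
  have hc : 0 < |d| * a ^ d * r ^ 2 :=
    mul_pos (mul_pos (abs_pos.2 hd0.ne) (Real.rpow_pos_of_pos ha d)) (by positivity)
  have hJ : Tendsto (fun h => J (h * r) / (h * r + a) ^ (d - 1)) atTop
      (𝓝 (|d| * a ^ d * r ^ 2)) := by
    rw [abs_of_neg hd0]
    exact (tendsto_integral_shiftedPowerDecr ha hd0 hr).comp (tendsto_id.atTop_mul_const hr)
  have hpos : ∀ᶠ h : ℝ in atTop, 0 < (h * r + a) ^ (d - 1) := by
    filter_upwards [eventually_ge_atTop 0] with h hh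
    exact Real.rpow_pos_of_pos (by positivity) _
  refine ⟨?_, fun hv => ⟨?_, ?_⟩⟩
  · rcases eq_or_ne v 0 with hv | hv
    · simp only [hv, zero_mul]
      exact IsEquivalent.refl
    · refine isEquivalent_of_tendsto_one ?_
      have h1 := hJ.div_const (|d| * a ^ d * r ^ 2)
      rw [div_self hc.ne'] at h1
      refine h1.congr fun h => ?_
      rw [Pi.div_apply, mul_assoc v, mul_assoc v, mul_assoc v, mul_div_mul_left _ _ hv, div_div,
        mul_comm (_ ^ (d - 1))]
  · filter_upwards [hJ.eventually_const_lt hc, hpos] with h h1 h2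
    exact mul_pos hv ((div_pos_iff_of_pos_right h2).1 h1)
  · have hratio : Tendsto (fun h : ℝ => (h * r + a) ^ (d - 1) / h ^ (d - 1)) atTop
        (𝓝 (r ^ (d - 1))) := by
      have h1 := ((tendsto_add_rpow_div_rpow a 0 (d - 1)).comp
        (tendsto_id.atTop_mul_const hr)).mul_const (r ^ (d - 1))
      rw [one_mul] at h1
      refine h1.congr' ?_
      filter_upwards [eventually_gt_atTop 0] with h hh
      have := (Real.rpow_pos_of_pos hr (d - 1)).ne'
      have := (Real.rpow_pos_of_pos hh (d - 1)).ne'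
      simp only [Function.comp, id, add_zero]
      rw [Real.mul_rpow hh.le hr.le]
      field_simp
    have hlim := (hJ.mul hratio).const_mul v
    refine (isTheta_of_div_tendsto_nhds_ne_zero (hlim.congr' ?_)
      (mul_pos hv (mul_pos hc (Real.rpow_pos_of_pos hr _))).ne').symm
    filter_upwards [hpos] with h h1
    field_simp
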